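/- A $d$-dimensional continuous vector addition system (CVAS) is a finite set $\Sigma\subset\mathbb{Z}^d$ of transitions; configurations are vectors in $\mathbb{Q}_{\ge 0}^d$. For a word $w=t_1\cdots t_k\in\Sigma^*$ and configurations $x,y$, we write $w\in L_\Sigma^{x,y}$ if there are rational firing fractions $\alpha_1,\dots,\alpha_k\in(0,1]$ and configurations $x=x_0,x_1,\dots,x_k=y$ in $\mathbb{Q}_{\ge 0}^d$ with $x_i=x_{i-1}+\alpha_i t_i$ for all $i$. A gathering $X=X_{a_1\dots a_n}^{b_1\dots b_n}$ over $\Sigma$ is given by two enumerations without repetition $a_1,\dots,a_n$ and $b_1,\dots,b_n$ of the same set of letters of $\Sigma$. Its language $L(X)$ is the set of words $w=a_1w_1\cdots a_nw_n\,b_1v_1\cdots b_nv_n$ with $w_i\in\{a_1,\dots,a_i\}^*$ and $v_i\in(\{a_1,\dots,a_n\}\setminus\{b_1,\dots,b_i\})^*$; this factorization is unique, and $\mathsf{center}(w)=w_n$ (the empty word if $n=0$). For $w\in L(X)$ let $(w)^\uparrow_X$ be the set of all $w'\in L(X)$ such that $\mathsf{center}(w)$ is a (scattered) subword of $\mathsf{center}(w')$.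 A path-scheme is an expression $\rho=u_0X_1u_1\cdots X_nu_n$ with $u_i\in\Sigma^*$, where each bubble $X_i$ is either a gathering or a star $X_A$ with $A\subseteq\Sigma$ and $L(X_A)=A^*$. Its language $L(\rho)$ is the set of words $w=u_0w_1u_1\cdots w_nu_n$ with $w_i\in L(X_i)$ for all $i$, and then $(w_1,\dots,w_n)$ is called a $\rho$-factor of $w$. The path-scheme $\rho$ is perfect (for $\Sigma,x,y$) if all its bubbles are gatherings and $L(\rho)\cap L_\Sigma^{x,y}\neq\emptyset$. For $\rho$ all of whose bubbles are gatherings and $w_i\in L(X_i)$, let $(w_1,\dots,w_n)^\uparrow_\rho$ be the set of words $u_0w_1'u_1\cdots w_n'u_n$ with $w_i'\in(w_i)^\uparrow_{X_i}$ for all $i$. **Theorem (Lifting Runs).** 1. (Gatherings) There is an algorithm that, given a CVAS $\Sigma$, configurations $x,y$ and a gathering $X$ over $\Sigma$ with $L(X)\cap L_\Sigma^{x,y}\neq\emptyset$, computes a word $w\in L(X)\cap L_\Sigma^{x,y}$ such that $(w)^\uparrow_X\subseteq L(X)\cap L_\Sigma^{x,y}$. 2. (Path-schemes) There is an algorithm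 that, given a CVAS $\Sigma$, configurations $x,y$ and a perfect path-scheme $\rho$ over $\Sigma$, computes a word $w\in L(\rho)\cap L_\Sigma^{x,y}$ and a $\rho$-factor $\vec w$ of $w$ such that $(\vec w)^\uparrow_\rho\subseteq L(\rho)\cap L_\Sigma^{x,y}$. -/

import Mathlib

open scoped NNRat

/-! ### Continuous vector addition systems -/

/-- A `d`-dimensional continuous vector addition system: a finite set of integer vectors, called
transitions. The subtype `↥T` of its transitions also serves as an alphabet. -/
abbrev CVAS (d : ℕ) := Finset (Fin d → ℤ)

/-- A configuration: a vector of non-negative rationals. -/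
abbrev Config (d : ℕ) := Fin d → ℚ≥0

namespace CVAS

variable {d : ℕ}

/-- The step `x --(α t)--> y`, i.e. `y = x + α t` with firing fraction `α ∈ (0, 1]`. Since `y` is a
configuration, no counter may become negative. -/
def Step (α : ℚ) (t : Fin d → ℤ) (x y : Config d) : Prop :=
  0 < α ∧ α ≤ 1 ∧ ∀ i, (y i : ℚ) = (x i : ℚ) + α * (t i : ℚ)

/-- `T.Run x w y`: there are firing fractions with which the word `w` leads from `x` to `y`. -/
inductive Run (T : CVAS d) : Config d → List T → Config d → Prop
  | nil (x : Config d) : Run T x [] x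
  | cons {x z y : Config d} {α : ℚ} {t : T} {w : List T} :
      Step α t.1 x z → Run T z w y → Run T x (t :: w) y

/-- The transition language of `T` from `x` to `y`. -/
def language (T : CVAS d) (x y : Config d) : Language T := {w | T.Run x w y}

end CVAS

/-! ### Gatherings -/

/-- A gathering over the alphabet `α`, given by the order `first = a₁, …, aₙ` of the first
appearances and the order `last = b₁, …, bₙ` of the last appearances of the same `n` distinct
letters. -/
structure Gathering (α : Type*) where
  size : ℕ
  first : Fin size → α
  last : Fin size → α
  first_injective : Function.Injective first
  last_injective : Function.Injective last
  range_eq : Set.range first = Set.range last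

namespace Gathering

variable {α : Type*}

/-- `w = a₁ w₁ … aₙ wₙ b₁ v₁ … bₙ vₙ` with `wᵢ ∈ {a₁, …, aᵢ}*` and
`vᵢ ∈ ({a₁, …, aₙ} \ {b₁, …, bᵢ})*`, and `c = wₙ` (`c` is empty in the degenerate case `n = 0`). -/
def HasCenter (X : Gathering α) (w c : List α) : Prop :=
  ∃ ws vs : Fin X.size → List α,
    (∀ i, ∀ t ∈ ws i, t ∈ X.first '' Set.Iic i) ∧
    (∀ i, ∀ t ∈ vs i, t ∈ Set.range X.first \ X.last '' Set.Iic i) ∧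
    w = (List.ofFn fun i => X.first i :: ws i).flatten ++
      (List.ofFn fun i => X.last i :: vs i).flatten ∧
    c = (List.ofFn ws).getLastD []

/-- The language of a gathering: all words that match it. -/
def language (X : Gathering α) : Language α := {w | ∃ c, X.HasCenter w c}

/-- The center `wₙ` of a word `w = a₁ w₁ … aₙ wₙ b₁ v₁ … bₙ vₙ` that matches the gathering. -/
noncomputable def center (X : Gathering α) (w : List α) : List α :=
  Classical.epsilon fun c => X.HasCenter w c

theorem split_unique {a : α} {p p' q q' : List α} (hp : a ∉ p) (hp' : a ∉ p')
    (h : p ++ a :: q = p' ++ a :: q') : p = p' ∧ q = q' := by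
  simp only [List.append_eq_append_iff, List.cons_eq_append_iff, List.cons_eq_cons] at h
  rcases h with ⟨c, rfl, ⟨rfl, h⟩ | ⟨d, rfl, h⟩⟩ | ⟨c, rfl, ⟨rfl, h⟩ | ⟨d, rfl, h⟩⟩ <;> simp_all

theorem split_unique_reverse {a : α} {p p' q q' : List α} (hq : a ∉ q) (hq' : a ∉ q')
    (h : p ++ a :: q = p' ++ a :: q') : p = p' ∧ q = q' := by
  have h2 := congrArg List.reverse h
  simp only [List.reverse_append, List.reverse_cons, List.append_assoc, List.singleton_append]
    at h2
  have h3 := split_unique (by simpa using hq) (by simpa using hq') h2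
  exact ⟨List.reverse_injective h3.2, List.reverse_injective h3.1⟩

theorem HasCenter.unique {X : Gathering α} {w c c' : List α} (h : X.HasCenter w c)
    (h' : X.HasCenter w c') : c = c' := by
  obtain ⟨n, a, b, ha, hb, hab⟩ := X
  obtain ⟨ws, vs, hws, hvs, rfl, rfl⟩ := h
  obtain ⟨ws', vs', hws', hvs', hw, rfl⟩ := h'
  dsimp only at *
  cases n with
  | zero => simp
  | succ n =>
    have key : ∀ ws : Fin (n + 1) → List α, (∀ i, ∀ t ∈ ws i, t ∈ a '' Set.Iic i) →
        a (Fin.last n) ∉ (List.ofFn fun i : Fin n =>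
          a i.castSucc :: ws i.castSucc).flatten := by
      intro ws hws hm
      simp only [List.mem_flatten, List.mem_ofFn', Set.mem_range] at hm
      obtain ⟨_, ⟨i, rfl⟩, hm⟩ := hm
      rcases List.mem_cons.1 hm with hm | hm
      · exact absurd (ha hm) (Fin.castSucc_lt_last i).ne'
      · obtain ⟨j, hj, hj'⟩ := hws _ _ hm
        rw [ha hj'] at hj
        exact absurd hj (not_le.2 (Fin.castSucc_lt_last i))
    have key' : ∀ vs : Fin (n + 1) → List α,
        (∀ i, ∀ t ∈ vs i, t ∈ Set.range a \ b '' Set.Iic i) →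
        b 0 ∉ vs 0 ++ (List.ofFn fun i : Fin n => b i.succ :: vs i.succ).flatten := by
      intro vs hvs hm
      have h0 : ∀ i, b 0 ∉ vs i := fun i hi => (hvs i _ hi).2 ⟨0, Fin.zero_le i, rfl⟩
      simp only [List.mem_append, List.mem_flatten, List.mem_ofFn', Set.mem_range] at hm
      rcases hm with hm | ⟨_, ⟨i, rfl⟩, hm⟩
      · exact h0 _ hm
      · rcases List.mem_cons.1 hm with hm | hm
        · exact absurd (hb hm) (Fin.succ_ne_zero i).symm
        · exact h0 _ hm
    have hlast : ∀ ws : Fin (n + 1) → List α, (List.ofFn ws).getLastD [] = ws (Fin.last n) := by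
      intro ws
      rw [List.ofFn_succ', List.concat_eq_append, List.getLastD_concat]
    rw [hlast, hlast]
    simp only [List.ofFn_succ' (fun i => a i :: _), List.ofFn_succ (f := fun i => b i :: _),
      List.concat_eq_append, List.flatten_append, List.flatten_cons, List.flatten_nil,
      List.append_nil, List.append_assoc, List.cons_append] at hw
    have h1 := (split_unique (key ws hws) (key ws' hws') hw).2
    exact (split_unique_reverse (key' vs hvs) (key' vs' hvs') h1).1

/-- The center does not depend on the chosen factorization. -/
theorem HasCenter.center_eq {X : Gathering α} {w c : List α} (h : X.HasCenter w c) :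
    X.center w = c :=
  (Classical.epsilon_spec (p := fun c => X.HasCenter w c) ⟨c, h⟩).unique h

/-- The words of the gathering whose center contains `center w` as a (scattered) subword. -/
def upClosure (X : Gathering α) (w : List α) : Language α :=
  {w' | w' ∈ X.language ∧ (X.center w).Sublist (X.center w')}

end Gathering

/-! ### Path-schemes -/

/-- A bubble is a star `X_A` for a finite set `A` of letters, or a gathering. -/
inductive Bubble (α : Type*) where
  | star (A : Finset α) : Bubble α
  | gathering (X : Gathering α) : Bubble α

namespace Bubble

variable {α : Type*}

/-- The language of a bubble; the language of the star `X_A` is `A*`. -/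
def language : Bubble α → Language α
  | star A => {w | ∀ t ∈ w, t ∈ A}
  | gathering X => X.language

/-- The upward closure of a word of a gathering. For stars there is no such notion, and the value
is a dummy. -/
def upClosure : Bubble α → List α → Language α
  | star _, _ => 0
  | gathering X, w => X.upClosure w

end Bubble

/-- A path-scheme `u₀ X₁ u₁ … Xₙ uₙ`. -/
structure PathScheme (α : Type*) where
  size : ℕ
  word : Fin (size + 1) → List α
  bubble : Fin size → Bubble α

namespace PathScheme

variable {α : Type*}

/-- The word `u₀ w₁ u₁ … wₙ uₙ`. -/
def assemble (ρ : PathScheme α) (ws : Fin ρ.size → List α) : List α :=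
  ρ.word 0 ++ (List.ofFn fun i => ws i ++ ρ.word i.succ).flatten

/-- `ws` is a `ρ`-factor of `w`. -/
def IsFactor (ρ : PathScheme α) (w : List α) (ws : Fin ρ.size → List α) : Prop :=
  (∀ i, ws i ∈ (ρ.bubble i).language) ∧ w = ρ.assemble ws

/-- The language of a path-scheme. -/
def language (ρ : PathScheme α) : Language α := {w | ∃ ws, ρ.IsFactor w ws}

/-- All bubbles are gatherings. -/
def IsPrePerfect (ρ : PathScheme α) : Prop := ∀ i, ∃ X, ρ.bubble i = .gathering X

/-- The `ρ`-upward closure of `ws`, for a pre-perfect path-scheme `ρ`: all words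
`u₀ w₁' u₁ … wₙ' uₙ` where each `wᵢ'` lies in the upward closure of `wᵢ`. -/
def upClosure (ρ : PathScheme α) (ws : Fin ρ.size → List α) : Language α :=
  {w' | ∃ ws', (∀ i, ws' i ∈ (ρ.bubble i).upClosure (ws i)) ∧ w' = ρ.assemble ws'}

/-- A path-scheme is perfect (for `T`, `x`, `y`) if it is pre-perfect and some word of its language
leads from `x` to `y`. -/
def IsPerfect {d : ℕ} {T : CVAS d} (ρ : PathScheme T) (x y : Config d) : Prop :=
  ρ.IsPrePerfect ∧ ∃ w, w ∈ ρ.language ⊓ T.language x y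

end PathScheme

/-! ### Finite encodings of inputs and outputs of algorithms -/

namespace Code

/-- Codes of vectors: lists of integers, where `z` is written as the pair of its positive and its
negative part. -/
abbrev Vec := List (ℕ × ℕ)

/-- Codes of configurations: lists of fractions, given by numerator and denominator. -/
abbrev Conf := List (ℕ × ℕ)

/-- Codes of words: lists of codes of letters. -/
abbrev Word := List Vec

/-- Codes of gatherings: the two lists of letters. -/
abbrev Gath := Word × Word

/-- Codes of bubbles: a list of the letters of a star, or the code of a gathering. -/
abbrev Bub := Word ⊕ Gath

/-- Codes of path-schemes: the list `u₀, …, uₙ` and the list `X₁, …, Xₙ`. -/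
abbrev Scheme := List Word × List Bub

/-- Codes of a CVAS, a source configuration, a target configuration, and a further object. -/
abbrev Input (γ : Type) := List Vec × Conf × Conf × γ

variable {d : ℕ} {T : CVAS d}

def ofVec (t : Fin d → ℤ) : Vec := List.ofFn fun i => ((t i).toNat, (-t i).toNat)

def ofConfig (x : Config d) : Conf := List.ofFn fun i => ((x i).num, (x i).den)

def ofWord (w : List T) : Word := w.map fun t => ofVec t.1

def ofGathering (X : Gathering T) : Gath := (ofWord (List.ofFn X.first), ofWord (List.ofFn X.last))

/-- `c` is a code of the bubble; a star may be coded by any list of the elements of its set. -/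
inductive IsBubble : Bubble T → Bub → Prop
  | star (A : Finset T) (l : List T) (h : ∀ t, t ∈ l ↔ t ∈ A) : IsBubble (.star A) (.inl (ofWord l))
  | gathering (X : Gathering T) : IsBubble (.gathering X) (.inr (ofGathering X))

/-- `c` is a code of the path-scheme `ρ`. -/
def IsScheme (ρ : PathScheme T) (c : Scheme) : Prop :=
  c.1 = List.ofFn (fun i => ofWord (ρ.word i)) ∧
    ∃ β : Fin ρ.size → Bub, (∀ i, IsBubble (ρ.bubble i) (β i)) ∧ c.2 = List.ofFn β

/-- `c` is a code of the CVAS `T`: it lists the codes of its transitions, in any order. -/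
def IsCVAS (T : CVAS d) (c : List Vec) : Prop :=
  ∃ l : List (Fin d → ℤ), (∀ t, t ∈ l ↔ t ∈ T) ∧ c = l.map ofVec

end Code

/-!
The algorithm searches for a word of a fixed shape together with a certificate that it can be lifted,
and this search succeeds because such a word exists whenever the gatherings have runs at all.

The word used for a gathering is the base word `a₁ … aₙ (a₁ … aₙ)ᴺ b₁ … bₙ`, with center
`(a₁ … aₙ)ᴺ`. What is certified is a *guarded* run on it: at every cut, all counters are positive
that are changed by some letter occurring both before and after the cut. Such runs are stable under
inserting a letter `t` at a cut that has `t` on both sides (`GRun.insert`): the new letter is fired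
with a tiny fraction `ε`, its next occurrence is shortened by `ε`, and the configurations in between
move by `ε t`, for which the guards leave room; the guards themselves remain satisfied. Every word of
the gathering whose center contains `(a₁ … aₙ)ᴺ` arises from the base word by such insertions, so a
guarded run on the base word lifts (`Gathering.wRun_of_mem_upClosure`).

Conversely, let some word of the gathering have a run from `x` to `y` (`Gathering.eventually_wRun`).
Since the letters can be fired from `x` in the order of their first appearances as far as the supports
of the configurations are concerned, firing `a₁ … aₙ` with tiny fractions leads to a configuration `m`
that is positive on all counters involved (`exists_tiny_prefix`), and the same holds backwards from
`y` for `b₁ … bₙ`, with a configuration `m'` (`exists_tiny_suffix`). The rest of the total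
displacement leads from `m` to `m'` along a straight line, which is followed closely by many rounds
through `a₁ … aₙ` (`GRun.eventually_rounds`). Hence there are guarded runs for all large `N`, and one
`N` serves all gatherings of a path-scheme (`CVAS.eventually_gRun`).

A guarded run with rational data is certified by natural numbers after multiplication with a common
denominator (`Code.CertOK`), and checking such a certificate is primitive recursive, so that an
unbounded search is partial recursive (`Code.partrec_search`). A gathering is a path-scheme with one
bubble, so the statement on gatherings follows from that on path-schemes.
-/

/-! ### Guarded runs -/

section GuardedRuns

open Filter Topology

variable {α ι : Type*}

/-- A guarded run from `x` to `y`. An item `(t, P, Q)` fires the letter `t`, whose effect is `v t`,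
with some fraction in `(0, 1]`; afterwards all counters are non-negative, and every counter on which
some letter in both `P` and `Q` has an effect is positive. -/
def GRun (v : α → ι → ℚ) : (ι → ℚ) → List (α × List α × List α) → (ι → ℚ) → Prop
  | x, [], y => x = y
  | x, (t, P, Q) :: G, y => ∃ ε : ℚ, 0 < ε ∧ ε ≤ 1 ∧ (∀ i, 0 ≤ (x + ε • v t) i) ∧
      (∀ u ∈ P, u ∈ Q → ∀ i, v u i ≠ 0 → 0 < (x + ε • v t) i) ∧ GRun v (x + ε • v t) G y

/-- The items of a word `w` that is read after the word `P`: at each cut, the guard consists of the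
letters that occur both before and after the cut. -/
def guarded : List α → List α → List (α × List α × List α)
  | _, [] => []
  | P, t :: w => (t, P ++ [t], w) :: guarded (P ++ [t]) w

/-- The items of a word without any guards. -/
def unguarded (w : List α) : List (α × List α × List α) := w.map fun t => (t, [], [])

variable {v : α → ι → ℚ}

theorem GRun.append_iff {G H : List (α × List α × List α)} {x y : ι → ℚ} :
    GRun v x (G ++ H) y ↔ ∃ z, GRun v x G z ∧ GRun v z H y := by
  induction G generalizing x with
  | nil => simp [GRun]
  | cons g G ih =>
    obtain ⟨t, P, Q⟩ := g
    simp only [List.cons_append, GRun, ih]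
    constructor
    · rintro ⟨ε, h1, h2, h3, h4, z, h5, h6⟩
      exact ⟨z, ⟨ε, h1, h2, h3, h4, h5⟩, h6⟩
    · rintro ⟨z, ⟨ε, h1, h2, h3, h4, h5⟩, h6⟩
      exact ⟨ε, h1, h2, h3, h4, z, h5, h6⟩

theorem GRun.nonneg {G : List (α × List α × List α)} {x y : ι → ℚ} (h : GRun v x G y)
    (hx : ∀ i, 0 ≤ x i) : ∀ i, 0 ≤ y i := by
  induction G generalizing x with
  | nil => exact h ▸ hx
  | cons g G ih =>
    obtain ⟨t, P, Q⟩ := g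
    obtain ⟨ε, -, -, h3, -, h5⟩ := h
    exact ih h5 h3

/-- Only the set of the letters read before matters, and runs persist if it shrinks. -/
theorem GRun.mono_prefix {P P' s : List α} {x y : ι → ℚ} (hP : ∀ u ∈ P', u ∈ P)
    (h : GRun v x (guarded P s) y) : GRun v x (guarded P' s) y := by
  induction s generalizing x P P' with
  | nil => exact h
  | cons t s ih =>
    obtain ⟨ε, h1, h2, h3, h4, h5⟩ := h
    have hP' : ∀ u ∈ P' ++ [t], u ∈ P ++ [t] := by
      simp only [List.mem_append]
      exact fun u hu => hu.imp (hP u) id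
    exact ⟨ε, h1, h2, h3, fun u hu => h4 u (hP' u hu), ih hP' h5⟩

theorem eventually_pos_add_smul [Finite ι] (x u : ι → ℚ) :
    ∀ᶠ ε : ℚ in 𝓝[>] 0, ∀ i, 0 < x i → 0 < (x + ε • u) i := by
  refine eventually_all.2 fun i => ?_
  by_cases hx : 0 < x i
  · have : Tendsto (fun ε : ℚ => (x + ε • u) i) (𝓝 0) (𝓝 (x i)) := by
      have h : Continuous fun ε : ℚ => x i + ε * u i := by fun_prop
      simpa using h.tendsto 0
    filter_upwards [(this.mono_left nhdsWithin_le_nhds).eventually_const_lt hx] with ε h _ using h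
  · exact Eventually.of_forall fun ε h => absurd h hx

theorem eventually_small {δ : ℚ} (hδ : 0 < δ) : ∀ᶠ ε : ℚ in 𝓝[>] 0, 0 < ε ∧ ε ≤ δ :=
  Ioc_mem_nhdsGT hδ

/-- A tiny shift of the source by `ε t` can be absorbed by a smaller fraction at the next occurrence
of `t`. -/
theorem GRun.shift [Finite ι] {P s : List α} {x y : ι → ℚ} {t : α} (hP : t ∈ P) (hs : t ∈ s)
    (h : GRun v x (guarded P s) y) :
    ∀ᶠ ε : ℚ in 𝓝[>] 0, GRun v (x + ε • v t) (guarded P s) y := by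
  induction s generalizing x P with
  | nil => simp at hs
  | cons t' s ih =>
    obtain ⟨δ, h1, h2, h3, h4, h5⟩ := h
    by_cases ht : t' = t
    · subst ht
      filter_upwards [eventually_small (half_pos h1)] with ε hε
      have e : x + ε • v t' + (δ - ε) • v t' = x + δ • v t' := by
        rw [add_assoc, ← add_smul]; congr 2; ring
      refine ⟨δ - ε, by linarith, by linarith, ?_⟩
      rw [e]
      exact ⟨h3, h4, h5⟩
    · have hs' : t ∈ s := (List.mem_cons.1 hs).resolve_left (Ne.symm ht)
      have hP' : t ∈ P ++ [t'] := List.mem_append_left _ hP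
      filter_upwards [ih hP' hs' h5, eventually_pos_add_smul (x + δ • v t') (v t)] with ε hε hpos
      have e : x + ε • v t + δ • v t' = x + δ • v t' + ε • v t := by abel
      refine ⟨δ, h1, h2, ?_⟩
      rw [e]
      refine ⟨fun i => ?_, fun u hu hu' i hi => hpos i (h4 u hu hu' i hi), hε⟩
      by_cases hi : v t i = 0
      · simpa [hi] using h3 i
      · exact (hpos i (h4 t hP' hs' i hi)).le

/-- A letter that occurs before and after a cut can be inserted at this cut: it is fired with a tiny
fraction, which is saved at its next occurrence. In between, the guards provide the room. -/
theorem GRun.insert [Finite ι] {P p s : List α} {x y : ι → ℚ} {t : α} (hx : ∀ i, 0 ≤ x i)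
    (hg : ∀ u ∈ P, u ∈ p ++ s → ∀ i, v u i ≠ 0 → 0 < x i) (hP : t ∈ P ++ p) (hs : t ∈ s)
    (h : GRun v x (guarded P (p ++ s)) y) : GRun v x (guarded P (p ++ t :: s)) y := by
  induction p generalizing x P with
  | nil =>
    simp only [List.append_nil, List.nil_append] at *
    obtain ⟨ε, hε, ⟨h1, h2⟩, h3⟩ := ((h.shift hP hs).and ((eventually_small one_pos).and
      (eventually_pos_add_smul x (v t)))).exists
    have hsub : ∀ u ∈ P ++ [t], u ∈ P := by
      simp only [List.mem_append, List.mem_singleton]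
      rintro u (hu | rfl)
      exacts [hu, hP]
    refine ⟨ε, h1, h2, fun i => ?_, fun u hu hu' i hi => h3 i (hg u (hsub u hu) hu' i hi),
      hε.mono_prefix hsub⟩
    by_cases hi : v t i = 0
    · simpa [hi] using hx i
    · exact (h3 i (hg t hP hs i hi)).le
  | cons a p ih =>
    obtain ⟨δ, h1, h2, h3, h4, h5⟩ := h
    refine ⟨δ, h1, h2, h3, fun u hu hu' => h4 u hu ?_, ih h3 h4 (by simpa using hP) h5⟩
    simp only [List.append_eq, List.mem_append, List.mem_cons] at hu' ⊢
    rcases hu' with h | rfl | h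
    exacts [.inl h, .inr hs, .inr h]

/-- The guarded runs on the word `w`, as read from its beginning. -/
def WRun (v : α → ι → ℚ) (x : ι → ℚ) (w : List α) (y : ι → ℚ) : Prop := GRun v x (guarded [] w) y

theorem WRun.insert [Finite ι] {p s : List α} {x y : ι → ℚ} {t : α} (hx : ∀ i, 0 ≤ x i)
    (hp : t ∈ p) (hs : t ∈ s) (h : WRun v x (p ++ s) y) : WRun v x (p ++ t :: s) y :=
  GRun.insert hx (by simp) (by simpa using hp) hs h

/-- Repeated insertion: the subword `m` is enlarged to `m'`. -/
theorem WRun.sublist [Finite ι] {m m' p s : List α} {x y : ι → ℚ} (hx : ∀ i, 0 ≤ x i)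
    (hm : m.Sublist m') (hp : ∀ t ∈ m', t ∈ p) (hs : ∀ t ∈ m', t ∈ s)
    (h : WRun v x (p ++ (m ++ s)) y) : WRun v x (p ++ (m' ++ s)) y := by
  induction hm generalizing p with
  | slnil => exact h
  | cons a hm ih =>
    exact (ih (fun t ht => hp t (.tail _ ht)) (fun t ht => hs t (.tail _ ht)) h).insert hx
      (hp a (.head _)) (List.mem_append_right _ (hs a (.head _)))
  | cons_cons a hm ih =>
    have := ih (p := p ++ [a]) (fun t ht => List.mem_append_left _ (hp t (.tail _ ht)))
      (fun t ht => hs t (.tail _ ht)) (by simpa using h)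
    simpa using this

/-- Insertion of words `g.2` behind the letters `g.1` of a word. -/
theorem WRun.insert_blocks [Finite ι] {A : List (α × List α)} {p s : List α} {x y : ι → ℚ}
    (hx : ∀ i, 0 ≤ x i)
    (hA : ∀ A₁ g A₂, A = A₁ ++ g :: A₂ → ∀ t ∈ g.2,
      t ∈ p ++ A₁.map Prod.fst ++ [g.1] ∧ t ∈ A₂.map Prod.fst ++ s)
    (h : WRun v x (p ++ (A.map Prod.fst ++ s)) y) :
    WRun v x (p ++ ((A.map fun g => g.1 :: g.2).flatten ++ s)) y := by
  induction A generalizing p with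
  | nil => exact h
  | cons g A ih =>
    have h0 := hA [] g A rfl
    have h1 : WRun v x ((p ++ [g.1]) ++ (g.2 ++ (A.map Prod.fst ++ s))) y := by
      refine WRun.sublist hx (List.nil_sublist _) (fun t ht => ?_) (fun t ht => (h0 t ht).2) ?_
      · simpa using (h0 t ht).1
      · simpa using h
    have h2 := ih (p := p ++ g.1 :: g.2) (fun A₁ g' A₂ hA' t ht => ?_) (by simpa using h1)
    · simpa using h2
    · have := hA (g :: A₁) g' A₂ (by simp [hA']) t ht
      refine ⟨?_, this.2⟩
      have := this.1
      simp only [List.map_cons, List.mem_append, List.mem_cons] at this ⊢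
      tauto

end GuardedRuns

/-! ### Existence of guarded runs -/

section Existence

open Filter Topology

variable {α ι : Type*} {v : α → ι → ℚ}

/-- A letter with a negative effect on a counter needs a positive source value, or a letter before
it that increases the counter. -/
theorem GRun.source_pos {p s : List α} {t : α} {x y : ι → ℚ} (hx : ∀ i, 0 ≤ x i)
    (h : GRun v x (unguarded (p ++ t :: s)) y) {i : ι} (hi : v t i < 0) :
    0 < x i ∨ ∃ u ∈ p, 0 < v u i := by
  induction p generalizing x with
  | nil =>
    obtain ⟨ε, h1, -, h3, -, -⟩ := h
    have := h3 i
    simp only [Pi.add_apply, Pi.smul_apply, smul_eq_mul] at this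
    left
    nlinarith [mul_neg_of_pos_of_neg h1 hi]
  | cons a p ih =>
    obtain ⟨ε, h1, -, h3, -, h5⟩ := h
    rcases ih h3 h5 with h | ⟨u, hu, hu'⟩
    · by_cases ha : 0 < v a i
      · exact .inr ⟨a, .head _, ha⟩
      · simp only [Pi.add_apply, Pi.smul_apply, smul_eq_mul] at h
        left
        nlinarith [mul_nonpos_of_nonneg_of_nonpos h1.le (not_lt.1 ha)]
    · exact .inr ⟨u, .tail _ hu, hu'⟩

theorem GRun.target_pos_of_pos {s : List α} {x y : ι → ℚ}
    (h : GRun v x (unguarded s) y) {i : ι} (hi : 0 < x i) :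
    0 < y i ∨ ∃ u ∈ s, v u i < 0 := by
  induction s generalizing x with
  | nil => exact .inl (h ▸ hi)
  | cons a s ih =>
    obtain ⟨ε, h1, -, h3, -, h5⟩ := h
    by_cases ha : v a i < 0
    · exact .inr ⟨a, .head _, ha⟩
    · have : 0 < (x + ε • v a) i := by
        simp only [Pi.add_apply, Pi.smul_apply, smul_eq_mul]
        have := mul_nonneg h1.le (not_lt.1 ha)
        linarith
      exact (ih h5 this).imp_right fun ⟨u, hu, hu'⟩ => ⟨u, .tail _ hu, hu'⟩

/-- Backward analogue of `GRun.source_pos`. -/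
theorem GRun.target_pos {p s : List α} {t : α} {x y : ι → ℚ} (hx : ∀ i, 0 ≤ x i)
    (h : GRun v x (unguarded (p ++ t :: s)) y) {i : ι} (hi : 0 < v t i) :
    0 < y i ∨ ∃ u ∈ s, v u i < 0 := by
  rw [unguarded, List.map_append, GRun.append_iff] at h
  obtain ⟨z, hz, ε, h1, -, -, -, h5⟩ := h
  refine GRun.target_pos_of_pos h5 ?_
  have := hz.nonneg hx i
  simp only [Pi.add_apply, Pi.smul_apply, smul_eq_mul]
  have := mul_pos h1 hi
  linarith

theorem sum_add_single [Fintype α] [DecidableEq α] (c : α → ℚ) (a : α) (ε : ℚ) :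
    ∑ t, (c + Pi.single a ε : α → ℚ) t • v t = ∑ t, c t • v t + ε • v a := by
  simp only [Pi.add_apply, add_smul, Finset.sum_add_distrib]
  rw [Finset.sum_eq_single a (f := fun t => (Pi.single a ε : α → ℚ) t • v t)]
  · simp
  · intro b _ hb; simp [hb]
  · simp

/-- The total displacement of a run as a combination of the letters, with the total fraction
of each letter as its coefficient. -/
theorem GRun.exists_coeff [Fintype α] [DecidableEq α] {w : List α} {x y : ι → ℚ}
    (h : GRun v x (unguarded w) y) :
    ∃ β : α → ℚ, y = x + ∑ t, β t • v t ∧ (∀ t ∈ w, 0 < β t) ∧ ∀ t ∉ w, β t = 0 := by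
  induction w generalizing x with
  | nil => exact ⟨0, by simpa using Eq.symm h, by simp⟩
  | cons a w ih =>
    obtain ⟨ε, h1, -, h3, -, h5⟩ := h
    obtain ⟨β, hy, hβ, hβ'⟩ := ih h5
    have hnn : ∀ t, 0 ≤ β t := fun t => by
      by_cases ht : t ∈ w
      exacts [(hβ t ht).le, (hβ' t ht).ge]
    refine ⟨β + Pi.single a ε, ?_, fun t ht => ?_, fun t ht => ?_⟩
    · rw [sum_add_single, hy]; abel
    · by_cases hta : t = a
      · subst hta; simpa using add_pos_of_nonneg_of_pos (hnn t) h1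
      · simpa [hta] using hβ t ((List.mem_cons.1 ht).resolve_left hta)
    · simp only [List.mem_cons, not_or] at ht
      simp [ht.1, hβ' t ht.2]

/-- Coefficients `c t ∈ [0, δ]` that vanish outside of the word `l`. -/
def SmallOn (l : List α) (δ : ℚ) (c : α → ℚ) : Prop :=
  (∀ t, 0 ≤ c t) ∧ (∀ t, c t ≤ δ) ∧ ∀ t ∉ l, c t = 0

theorem SmallOn.add_single [DecidableEq α] {l : List α} {δ ε : ℚ} {c : α → ℚ} {a : α}
    (h : SmallOn l (δ / 2) c) (h0 : 0 ≤ ε) (hε : ε ≤ δ / 2) :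
    SmallOn (a :: l) δ (c + Pi.single a ε) := by
  obtain ⟨h1, h2, h3⟩ := h
  refine ⟨fun t => ?_, fun t => ?_, fun t ht => ?_⟩
  · by_cases hta : t = a
    · subst hta; simpa using add_nonneg (h1 t) h0
    · simpa [hta] using h1 t
  · by_cases hta : t = a
    · subst hta
      have := h2 t
      simp only [Pi.add_apply, Pi.single_eq_same]
      linarith
    · have := h2 t
      simp only [Pi.add_apply, ne_eq, hta, not_false_eq_true, Pi.single_eq_of_ne, add_zero]
      linarith
  · simp only [List.mem_cons, not_or] at ht
    simp [ht.1, h3 t ht.2]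

/-- Firing a word with tiny fractions makes all counters positive that it has an effect on. -/
theorem exists_tiny_prefix [Fintype α] [DecidableEq α] [Finite ι] (l P : List α) (x : ι → ℚ)
    (hx : ∀ i, 0 ≤ x i) (hP : ∀ u ∈ P, ∀ i, v u i ≠ 0 → 0 < x i)
    (hl : ∀ p t s, l = p ++ t :: s → ∀ i, v t i < 0 → 0 < x i ∨ ∃ u ∈ p, 0 < v u i)
    {δ : ℚ} (hδ : 0 < δ) :
    ∃ m c, m = x + ∑ t, c t • v t ∧ SmallOn l δ c ∧ (∀ i, 0 ≤ m i) ∧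
      (∀ u ∈ P ++ l, ∀ i, v u i ≠ 0 → 0 < m i) ∧
      ∀ s y, GRun v m (guarded (P ++ l) s) y → GRun v x (guarded P (l ++ s)) y := by
  induction l generalizing x P δ with
  | nil =>
    refine ⟨x, 0, by simp, ⟨by simp, fun _ => hδ.le, by simp⟩, hx, by simpa using hP, ?_⟩
    simp
  | cons a l ih =>
    obtain ⟨ε, ⟨h0, hε⟩, ⟨-, h1⟩, hpos⟩ := ((eventually_small (half_pos hδ)).and
      ((eventually_small one_pos).and (eventually_pos_add_smul x (v a)))).exists
    set z := x + ε • v a with hz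
    have hinc : ∀ i, 0 < v a i → 0 < z i := fun i hi => by
      have := mul_pos h0 hi
      have := hx i
      simp only [hz, Pi.add_apply, Pi.smul_apply, smul_eq_mul]
      linarith
    have hdec : ∀ i, v a i < 0 → 0 < z i := fun i hi =>
      hpos i ((hl [] a l rfl i hi).resolve_right (by simp))
    have hz0 : ∀ i, 0 ≤ z i := fun i => by
      rcases lt_trichotomy (v a i) 0 with h | h | h
      · exact (hdec i h).le
      · simpa [hz, h] using hx i
      · exact (hinc i h).le
    have hzP : ∀ u ∈ P ++ [a], ∀ i, v u i ≠ 0 → 0 < z i := by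
      intro u hu i hi
      simp only [List.mem_append, List.mem_singleton] at hu
      rcases hu with hu | rfl
      · exact hpos i (hP u hu i hi)
      · exact (lt_or_gt_of_ne hi).elim (hdec i) (hinc i)
    obtain ⟨m, c, hm, hc, hm0, hmP, hrun⟩ := ih (P ++ [a]) z hz0 hzP (fun p t s hs i hi => by
      rcases hl (a :: p) t s (by simp [hs]) i hi with h | ⟨u, hu, hu'⟩
      · exact .inl (hpos i h)
      · rcases List.mem_cons.1 hu with rfl | hu
        · exact .inl (hinc i hu')
        · exact .inr ⟨u, hu, hu'⟩) (half_pos hδ)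
    refine ⟨m, c + Pi.single a ε, ?_, hc.add_single h0.le hε, hm0, by simpa using hmP, ?_⟩
    · rw [sum_add_single, hm, hz]; abel
    · intro s y h
      exact ⟨ε, h0, h1, hz0, fun u hu _ => hzP u hu, hrun s y (by simpa using h)⟩

/-- Backward analogue of `exists_tiny_prefix`. -/
theorem exists_tiny_suffix [Fintype α] [DecidableEq α] [Finite ι] (l : List α) (y : ι → ℚ)
    (hy : ∀ i, 0 ≤ y i)
    (hl : ∀ p t s, l = p ++ t :: s → ∀ i, 0 < v t i → 0 < y i ∨ ∃ u ∈ s, v u i < 0)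
    {δ : ℚ} (hδ : 0 < δ) :
    ∃ m c, y = m + ∑ t, c t • v t ∧ SmallOn l δ c ∧ (∀ i, 0 ≤ m i) ∧
      (∀ u ∈ l, ∀ i, v u i ≠ 0 → 0 < m i) ∧ (∀ i, 0 < y i → 0 < m i) ∧
      ∀ P, GRun v m (guarded P l) y := by
  induction l generalizing δ with
  | nil =>
    exact ⟨y, 0, by simp, ⟨by simp, fun _ => hδ.le, by simp⟩, hy, by simp, by simp,
      fun _ => rfl⟩
  | cons a l ih =>
    obtain ⟨z, c, hz, hc, hz0, hzl, hzy, hrun⟩ := ih (fun p t s hs => hl (a :: p) t s (by simp [hs]))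
      (half_pos hδ)
    obtain ⟨ε, ⟨h0, hε⟩, ⟨-, h1⟩, hpos⟩ := ((eventually_small (half_pos hδ)).and
      ((eventually_small one_pos).and (eventually_pos_add_smul z (-v a)))).exists
    set m := z + ε • (-v a) with hm
    have hmz : m + ε • v a = z := by rw [hm]; simp
    have hdec : ∀ i, v a i < 0 → 0 < m i := fun i hi => by
      have := mul_neg_of_pos_of_neg h0 hi
      have := hz0 i
      simp only [hm, Pi.add_apply, Pi.smul_apply, Pi.neg_apply, smul_eq_mul]
      linarith
    have hinc : ∀ i, 0 < v a i → 0 < m i := fun i hi => by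
      refine hpos i ?_
      rcases hl [] a l rfl i hi with h | ⟨u, hu, hu'⟩
      exacts [hzy i h, hzl u hu i hu'.ne]
    refine ⟨m, c + Pi.single a ε, ?_, hc.add_single h0.le hε, fun i => ?_, fun u hu i hi => ?_,
      fun i hi => hpos i (hzy i hi), fun P => ?_⟩
    · rw [sum_add_single, hz, ← hmz]; abel
    · rcases lt_trichotomy (v a i) 0 with h | h | h
      · exact (hdec i h).le
      · simpa [hm, h] using hz0 i
      · exact (hinc i h).le
    · rcases List.mem_cons.1 hu with rfl | hu
      · exact (lt_or_gt_of_ne hi).elim (hdec i) (hinc i)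
      · exact hpos i (hzl u hu i hi)
    · refine ⟨ε, h0, h1, ?_⟩
      rw [hmz]
      exact ⟨hz0, fun u _ hu => hzl u hu, hrun _⟩

/-- A round through `l` in which the letter `t` is fired with fraction `c t`, and in which all
counters stay positive that the letters have an effect on. -/
theorem GRun.round {c : α → ℚ} (l P s : List α) (q y : ι → ℚ) (hq0 : ∀ i, 0 ≤ q i)
    (hc : ∀ t ∈ l, 0 < c t ∧ c t ≤ 1) (hl : ∀ t ∈ l, t ∈ P)
    (hq : ∀ u ∈ P, ∀ i, v u i ≠ 0 → (l.map fun t => c t * |v t i|).sum < q i)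
    (h : GRun v (q + (l.map fun t => c t • v t).sum) (guarded (P ++ l) s) y) :
    GRun v q (guarded P (l ++ s)) y := by
  induction l generalizing P q with
  | nil => simpa using h
  | cons a l ih =>
    have ha := hc a (.head _)
    have key : ∀ u ∈ P, ∀ i, v u i ≠ 0 →
        (l.map fun t => c t * |v t i|).sum < (q + c a • v a) i := fun u hu i hi => by
      have := hq u hu i hi
      simp only [List.map_cons, List.sum_cons] at this
      simp only [Pi.add_apply, Pi.smul_apply, smul_eq_mul]
      have : c a * -|v a i| ≤ c a * v a i := mul_le_mul_of_nonneg_left (neg_abs_le _) ha.1.le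
      linarith
    have hsum : ∀ i, 0 ≤ (l.map fun t => c t * |v t i|).sum := fun i =>
      List.sum_nonneg (by
        simp only [List.mem_map]
        rintro _ ⟨t, ht, rfl⟩
        exact mul_nonneg (hc t (.tail _ ht)).1.le (abs_nonneg _))
    have hP : ∀ u ∈ P ++ [a], u ∈ P := by
      simp only [List.mem_append, List.mem_singleton]
      rintro u (hu | rfl)
      exacts [hu, hl _ (.head _)]
    have h0 : ∀ i, 0 ≤ (q + c a • v a) i := fun i => by
      by_cases hi : v a i = 0
      · simpa [hi] using hq0 i
      · exact (hsum i).trans (key a (hl _ (.head _)) i hi).le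
    refine ⟨c a, ha.1, ha.2, h0,
      fun u hu _ i hi => (hsum i).trans_lt (key u (hP u hu) i hi), ?_⟩
    refine ih (P ++ [a]) _ h0 (fun t ht => hc t (.tail _ ht))
      (fun t ht => List.mem_append_left _ (hl t (.tail _ ht)))
      (fun u hu i hi => key u (hP u hu) i hi) ?_
    simpa [add_assoc] using h

/-- Going from `m` to `m'` along a straight line, in sufficiently many rounds through `l`. -/
theorem GRun.eventually_rounds [Finite α] [Finite ι] {b : α → ℚ} {l s : List α} {m m' y : ι → ℚ}
    (hm0 : ∀ i, 0 ≤ m i) (hm0' : ∀ i, 0 ≤ m' i)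
    (hm : ∀ u ∈ l, ∀ i, v u i ≠ 0 → 0 < m i) (hm' : ∀ u ∈ l, ∀ i, v u i ≠ 0 → 0 < m' i)
    (hb : ∀ t ∈ l, 0 < b t) (hmm : m' = m + (l.map fun t => b t • v t).sum)
    (h : ∀ P, GRun v m' (guarded P s) y) :
    ∀ᶠ N : ℕ in atTop, GRun v m (guarded l ((List.replicate N l).flatten ++ s)) y := by
  have large : ∀ r : ℚ, ∀ᶠ N : ℕ in atTop, r < N := fun r =>
    tendsto_natCast_atTop_atTop.eventually_gt_atTop r
  have h1 : ∀ᶠ N : ℕ in atTop, ∀ t, b t < N := eventually_all.2 fun t => large _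
  have h2 : ∀ᶠ N : ℕ in atTop, ∀ i, (l.map fun t => b t * |v t i|).sum / m i < N :=
    eventually_all.2 fun t => large _
  have h3 : ∀ᶠ N : ℕ in atTop, ∀ i, (l.map fun t => b t * |v t i|).sum / m' i < N :=
    eventually_all.2 fun t => large _
  filter_upwards [h1, h2, h3, eventually_gt_atTop 0] with N h1 h2 h3 hN
  have hN' : (0 : ℚ) < N := by exact_mod_cast hN
  have hd : (l.map fun t => (b t / N) • v t).sum = (1 / N : ℚ) • (m' - m) := by
    rw [hmm, add_sub_cancel_left, List.smul_sum, List.map_map]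
    congr 1
    refine List.map_congr_left fun t _ => ?_
    rw [Function.comp_apply, smul_smul]; congr 1; ring
  have hs : ∀ i, (l.map fun t => b t / N * |v t i|).sum
      = (l.map fun t => b t * |v t i|).sum / N := fun i => by
    rw [div_eq_mul_inv, ← List.sum_map_mul_right]
    congr 1
    refine List.map_congr_left fun t _ => ?_
    ring
  -- The run is built from its end; `k` is the number of rounds that are left.
  have main : ∀ k : ℕ, k ≤ N → ∀ P, (∀ u, u ∈ P ↔ u ∈ l) →
      GRun v (m' - (k / N : ℚ) • (m' - m)) (guarded P ((List.replicate k l).flatten ++ s)) y := by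
    intro k
    induction k with
    | zero => intro _ P _; simpa using h P
    | succ k ih =>
      intro hk P hP
      have hk' : ((k + 1 : ℕ) : ℚ) / N ≤ 1 := by
        rw [div_le_one hN']; exact_mod_cast hk
      have hk0 : (0 : ℚ) ≤ ((k + 1 : ℕ) : ℚ) / N := by positivity
      set r : ℚ := ((k + 1 : ℕ) : ℚ) / N with hr
      have hri : ∀ i, (m' - r • (m' - m)) i = r * m i + (1 - r) * m' i := fun i => by
        simp only [Pi.sub_apply, Pi.smul_apply, smul_eq_mul]; ring
      simp only [List.replicate_succ, List.flatten_cons, List.append_assoc]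
      refine GRun.round (c := fun t => b t / N) l P _ _ y (fun i => ?_) (fun t ht => ?_)
        (fun t ht => (hP t).2 ht) (fun u hu i hi => ?_) ?_
      · rw [hri]
        exact add_nonneg (mul_nonneg hk0 (hm0 i)) (mul_nonneg (sub_nonneg.2 hk') (hm0' i))
      · exact ⟨div_pos (hb t ht) hN', (div_le_one hN').2 (h1 t).le⟩
      · have hmi := hm u ((hP u).1 hu) i hi
        have hmi' := hm' u ((hP u).1 hu) i hi
        rw [hs, hri]
        have e1 := h2 i
        have e2 := h3 i
        rw [div_lt_iff₀ hmi] at e1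
        rw [div_lt_iff₀ hmi'] at e2
        rw [div_lt_iff₀ hN']
        set S := (l.map fun t => b t * |v t i|).sum
        rcases eq_or_lt_of_le hk0 with h0 | h0
        · rw [← h0]; linarith
        · have := mul_lt_mul_of_pos_left e1 h0
          have := mul_le_mul_of_nonneg_left e2.le (sub_nonneg.2 hk')
          linarith
      · rw [hd]
        have e : m' - r • (m' - m) + (1 / N : ℚ) • (m' - m) = m' - (k / N : ℚ) • (m' - m) := by
          rw [sub_add, ← sub_smul]
          congr 2
          rw [hr]; push_cast; ring
        rw [e]
        refine ih (by omega) _ fun u => ?_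
        simp [hP]
  have := main N le_rfl l fun _ => Iff.rfl
  rwa [div_self hN'.ne', one_smul, sub_sub_cancel] at this

/-- If the letters of `a`, in this order, can be fired from `x`, those of `b` can be fired backwards
from `y`, and a positive combination of these letters leads from `x` to `y`, then there is a guarded
run on `a aᴺ b` for every large `N`. -/
theorem WRun.eventually_of_coeff [Fintype α] [DecidableEq α] [Finite ι] {a b : List α}
    {x y : ι → ℚ} {β : α → ℚ} (ha : a.Nodup) (hab : ∀ t, t ∈ b ↔ t ∈ a)
    (hx : ∀ i, 0 ≤ x i) (hy : ∀ i, 0 ≤ y i)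
    (hax : ∀ p t s, a = p ++ t :: s → ∀ i, v t i < 0 → 0 < x i ∨ ∃ u ∈ p, 0 < v u i)
    (hby : ∀ p t s, b = p ++ t :: s → ∀ i, 0 < v t i → 0 < y i ∨ ∃ u ∈ s, v u i < 0)
    (hxy : y = x + ∑ t, β t • v t) (hβ : ∀ t ∈ a, 0 < β t) (hβ' : ∀ t ∉ a, β t = 0) :
    ∀ᶠ N : ℕ in atTop, WRun v x (a ++ ((List.replicate N a).flatten ++ b)) y := by
  -- With `δ ≤ β t / 3`, a positive fraction of each letter is left for the middle part.
  have hsmall : ∀ᶠ δ : ℚ in 𝓝[>] 0, ∀ t, t ∈ a → δ ≤ β t / 3 := by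
    refine eventually_all.2 fun t => ?_
    by_cases ht : t ∈ a
    · filter_upwards [eventually_small (div_pos (hβ t ht) three_pos)] with δ h _ using h.2
    · exact Eventually.of_forall fun _ h => absurd h ht
  obtain ⟨δ, ⟨hδ, -⟩, hδβ⟩ := ((eventually_small one_pos).and hsmall).exists
  obtain ⟨m, c, hm, ⟨-, hc, hc'⟩, hm0, hma, hrun⟩ := exists_tiny_prefix a [] x hx (by simp) hax hδ
  obtain ⟨m', c₂, hm', ⟨-, hc₂, hc₂'⟩, hm0', hma', -, hrun'⟩ := exists_tiny_suffix b y hy hby hδ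
  simp only [List.nil_append] at hma hrun
  have hsum : (a.map fun t => (β t - c t - c₂ t) • v t).sum = ∑ t, (β t - c t - c₂ t) • v t := by
    rw [← List.sum_toFinset _ ha]
    refine Finset.sum_subset (Finset.subset_univ _) fun t _ ht => ?_
    rw [List.mem_toFinset] at ht
    rw [hβ' t ht, hc' t ht, hc₂' t (mt (hab t).1 ht)]
    simp
  have := GRun.eventually_rounds (b := fun t => β t - c t - c₂ t) (l := a) hm0 hm0' hma
    (fun u hu => hma' u ((hab u).2 hu)) (fun t ht => ?_) ?_ hrun'
  · exact this.mono fun N h => hrun _ _ h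
  · have := hδβ t ht
    have := hc t
    have := hc₂ t
    have := hβ t ht
    linarith
  · rw [hsum]
    simp only [sub_smul, Finset.sum_sub_distrib]
    rw [eq_sub_of_add_eq hm'.symm, hxy, hm]
    abel

end Existence

/-! ### Words of gatherings -/

section OfFn

variable {α : Type*} {n : ℕ} {f : Fin n → α}

theorem mem_take_ofFn {k : ℕ} {u : α} : u ∈ (List.ofFn f).take k ↔ ∃ j : Fin n, j < k ∧ f j = u := by
  rw [List.mem_take_iff_getElem]
  simp only [List.getElem_ofFn, List.length_ofFn, lt_min_iff]
  exact ⟨fun ⟨i, hi, h⟩ => ⟨⟨i, hi.2⟩, hi.1, h⟩, fun ⟨j, hj, h⟩ => ⟨j, ⟨hj, j.2⟩, h⟩⟩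

theorem mem_drop_ofFn {k : ℕ} {u : α} :
    u ∈ (List.ofFn f).drop k ↔ ∃ j : Fin n, k ≤ j ∧ f j = u := by
  rw [List.mem_drop_iff_getElem]
  simp only [List.getElem_ofFn, List.length_ofFn]
  constructor
  · rintro ⟨i, hi, h⟩
    exact ⟨⟨i + k, by omega⟩, Nat.le_add_left _ _, by simpa [add_comm] using h⟩
  · rintro ⟨j, hj, h⟩
    exact ⟨j - k, by omega, by simpa [Nat.add_sub_cancel' hj] using h⟩

theorem ofFn_eq_take_append (f : Fin n → α) (k : Fin n) :
    List.ofFn f = (List.ofFn f).take k ++ f k :: (List.ofFn f).drop (k + 1) := by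
  have h : (k : ℕ) < (List.ofFn f).length := by simp
  conv_lhs => rw [← List.take_append_drop k (List.ofFn f), List.drop_eq_getElem_cons h]
  simp

theorem eq_take_of_ofFn_eq_append {A₁ A₂ : List α} {g : α} (h : List.ofFn f = A₁ ++ g :: A₂) :
    ∃ k : Fin n, A₁ = (List.ofFn f).take k ∧ g = f k ∧ A₂ = (List.ofFn f).drop (k + 1) := by
  have hlen : A₁.length < n := by
    have := congrArg List.length h
    simp at this
    omega
  refine ⟨⟨A₁.length, hlen⟩, by simp [h], ?_, by simp [h]⟩
  have : (List.ofFn f)[A₁.length]'(by simpa) = g := by simp [h]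
  simpa using this.symm

end OfFn

namespace Gathering

open Filter

variable {α : Type*} (X : Gathering α)

/-- The word `a₁ … aₙ (a₁ … aₙ)ᴺ b₁ … bₙ`, whose center is `(a₁ … aₙ)ᴺ`. -/
def baseWord (N : ℕ) : List α :=
  List.ofFn X.first ++ ((List.replicate N (List.ofFn X.first)).flatten ++ List.ofFn X.last)

variable {X}

theorem mem_last_iff_mem_range_first {t : α} : t ∈ List.ofFn X.last ↔ t ∈ Set.range X.first := by
  rw [List.mem_ofFn', X.range_eq]

theorem hasCenter_baseWord (N : ℕ) :
    X.HasCenter (X.baseWord N) (List.replicate N (List.ofFn X.first)).flatten := by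
  have hsub : ∀ t ∈ (List.replicate N (List.ofFn X.first)).flatten, t ∈ Set.range X.first := by
    intro t ht
    simp only [List.mem_flatten, List.mem_replicate] at ht
    obtain ⟨_, ⟨-, rfl⟩, ht⟩ := ht
    rwa [List.mem_ofFn'] at ht
  unfold baseWord
  generalize (List.replicate N (List.ofFn X.first)).flatten = c at *
  obtain ⟨n, a, b, ha, hb, hab⟩ := X
  dsimp only at *
  cases n with
  | zero =>
    obtain rfl : c = [] := by
      cases c with
      | nil => rfl
      | cons t c => obtain ⟨i, -⟩ := hsub t (.head _); exact i.elim0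
    exact ⟨fun _ => [], fun _ => [], by simp, by simp, by simp, by simp⟩
  | succ n =>
    refine ⟨fun i => if i = Fin.last n then c else [], fun _ => [], fun i t ht => ?_, by simp,
      ?_, ?_⟩
    · dsimp only at ht
      split_ifs at ht with hi
      · subst hi
        obtain ⟨j, rfl⟩ := hsub t ht
        exact ⟨j, Fin.le_last j, rfl⟩
      · simp at ht
    · have h1 : ∀ i : Fin n, i.castSucc ≠ Fin.last n := fun i => (Fin.castSucc_lt_last i).ne
      have h2 : ∀ (m : ℕ) (f : Fin m → α), (List.ofFn fun i => [f i]).flatten = List.ofFn f := by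
        intro m f
        rw [show (List.ofFn fun i => [f i]) = (List.ofFn f).map fun t => [t] by
          rw [List.map_ofFn]; rfl]
        induction List.ofFn f <;> simp_all
      rw [h2, List.ofFn_succ' (f := fun i => a i :: _), List.ofFn_succ' (f := a)]
      simp [h1, h2]
    · rw [List.ofFn_succ', List.concat_eq_append, List.getLastD_concat]
      simp

variable {ι : Type*} [Finite ι] {v : α → ι → ℚ}

/-- A guarded run on the base word can be lifted to all words of the gathering whose center
contains the center of the base word. -/
theorem wRun_of_mem_upClosure {N : ℕ} {x y : ι → ℚ} (hx : ∀ i, 0 ≤ x i)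
    (h : WRun v x (X.baseWord N) y) {w' : List α} (hw' : w' ∈ X.upClosure (X.baseWord N)) :
    WRun v x w' y := by
  obtain ⟨⟨c, hc⟩, hsub⟩ := hw'
  rw [hc.center_eq, (hasCenter_baseWord N).center_eq] at hsub
  unfold baseWord at h
  generalize (List.replicate N (List.ofFn X.first)).flatten = m at *
  obtain ⟨n, a, b, ha, hb, hab⟩ := X
  obtain ⟨ws, vs, hws, hvs, rfl, rfl⟩ := hc
  dsimp only at *
  cases n with
  | zero => obtain rfl : m = [] := by simpa using hsub
            simpa using h
  | succ n =>
    rw [List.ofFn_succ' (f := ws), List.concat_eq_append, List.getLastD_concat] at hsub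
    have hb' : ∀ t ∈ Set.range a, t ∈ List.ofFn b := fun t ht => by
      rwa [List.mem_ofFn', ← hab]
    have himg : ∀ (S : Set (Fin (n + 1))), ∀ t ∈ a '' S, t ∈ Set.range a := fun S t ht =>
      Set.image_subset_range _ _ ht
    have h1 : WRun v x (List.ofFn a ++ (ws (Fin.last n) ++ List.ofFn b)) y :=
      h.sublist hx hsub (fun t ht => (List.mem_ofFn' a t).2 (himg _ _ (hws _ _ ht)))
        fun t ht => hb' t (himg _ _ (hws _ _ ht))
    -- The last block is left out here, since `h1` already contains the word `ws (Fin.last n)`.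
    have h2 := WRun.insert_blocks (p := []) (s := ws (Fin.last n) ++ List.ofFn b)
      (A := List.ofFn fun i => (a i, if i = Fin.last n then [] else ws i)) hx (by
        intro A₁ g A₂ hA t ht
        obtain ⟨k, rfl, rfl, rfl⟩ := eq_take_of_ofFn_eq_append hA
        dsimp only at ht
        split_ifs at ht with hk
        · simp at ht
        obtain ⟨j, hj, rfl⟩ := hws _ _ ht
        refine ⟨?_, ?_⟩
        · rcases eq_or_lt_of_le (Set.mem_Iic.1 hj) with rfl | hj
          · simp
          · refine List.mem_append_left _ (List.mem_append_right _ (List.mem_map.2 ⟨_,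
              mem_take_ofFn.2 ⟨j, hj, rfl⟩, rfl⟩))
        · exact List.mem_append_right _ (List.mem_append_right _ (hb' _ ⟨j, rfl⟩)))
      (by simpa [List.map_ofFn, Function.comp_def] using h1)
    have h3 : WRun v x ((List.ofFn fun i => a i :: ws i).flatten ++ (List.ofFn b ++ [])) y := by
      have hne : ∀ i : Fin n, i.castSucc ≠ Fin.last n := fun i => (Fin.castSucc_lt_last i).ne
      rw [List.ofFn_succ' (f := fun i => a i :: _)]
      rw [List.ofFn_succ'] at h2
      simpa [hne, List.map_ofFn, Function.comp_def] using h2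
    -- A letter of `vs k` still occurs among the later letters `b j`, since `a` and `b` have the same
    -- range.
    have h4 := WRun.insert_blocks (p := (List.ofFn fun i => a i :: ws i).flatten) (s := [])
      (A := List.ofFn fun i => (b i, vs i)) hx (by
        intro B₁ g B₂ hB t ht
        obtain ⟨k, rfl, rfl, rfl⟩ := eq_take_of_ofFn_eq_append hB
        obtain ⟨⟨j, rfl⟩, hj⟩ := hvs _ _ ht
        refine ⟨?_, ?_⟩
        · refine List.mem_append_left _ (List.mem_append_left _ (List.mem_flatten.2 ⟨a j :: ws j,
            (List.mem_ofFn' _ _).2 ⟨j, rfl⟩, List.mem_cons_self⟩))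
        · obtain ⟨l, hl⟩ : a j ∈ Set.range b := hab ▸ ⟨j, rfl⟩
          have hkl : k < l := not_le.1 fun h => hj ⟨l, h, hl⟩
          exact List.mem_append_left _ (List.mem_map.2 ⟨_, mem_drop_ofFn.2 ⟨l, hkl, rfl⟩, hl⟩))
      (by simpa [List.map_ofFn, Function.comp_def] using h3)
    simpa [List.map_ofFn, Function.comp_def] using h4

/-- A run on some word of a gathering yields guarded runs on its base words. Only three facts about
the run are used: the total fractions of the letters, that the first appearances are enabled by
the letters before them, and the analogue for the last appearances in backward direction. -/
theorem eventually_wRun [Fintype α] [DecidableEq α] {x y : ι → ℚ} (hx : ∀ i, 0 ≤ x i) {w : List α}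
    (hw : w ∈ X.language) (h : GRun v x (unguarded w) y) :
    ∀ᶠ N in atTop, WRun v x (X.baseWord N) y := by
  obtain ⟨c, ws, vs, hws, hvs, hw, -⟩ := hw
  have hfirst : ∀ i, ∀ t ∈ X.first i :: ws i, ∃ j ≤ i, X.first j = t := fun i t ht => by
    rcases List.mem_cons.1 ht with rfl | ht
    · exact ⟨i, le_rfl, rfl⟩
    · exact hws i t ht
  have hlast : ∀ i, ∀ t ∈ vs i, ∃ j > i, X.last j = t := fun i t ht => by
    obtain ⟨ht, ht'⟩ := hvs i t ht
    rw [X.range_eq] at ht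
    obtain ⟨j, rfl⟩ := ht
    exact ⟨j, not_le.1 fun hj => ht' ⟨j, hj, rfl⟩, rfl⟩
  have hmem : ∀ t, t ∈ w ↔ t ∈ List.ofFn X.first := by
    intro t
    rw [hw, List.mem_append, List.mem_flatten, List.mem_flatten, List.mem_ofFn']
    constructor
    · rintro (⟨l, hl, ht⟩ | ⟨l, hl, ht⟩)
      · obtain ⟨i, rfl⟩ := (List.mem_ofFn' _ _).1 hl
        obtain ⟨j, -, rfl⟩ := hfirst i t ht
        exact ⟨j, rfl⟩
      · obtain ⟨i, rfl⟩ := (List.mem_ofFn' _ _).1 hl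
        rw [X.range_eq]
        rcases List.mem_cons.1 ht with rfl | ht
        · exact ⟨i, rfl⟩
        · obtain ⟨j, -, rfl⟩ := hlast i t ht
          exact ⟨j, rfl⟩
    · rintro ⟨i, rfl⟩
      exact .inl ⟨_, (List.mem_ofFn' _ _).2 ⟨i, rfl⟩, .head _⟩
  obtain ⟨β, hxy, hβ, hβ'⟩ := h.exists_coeff
  refine WRun.eventually_of_coeff (List.nodup_ofFn.2 X.first_injective) (fun t => ?_) hx
    (h.nonneg hx) ?_ ?_ hxy (fun t ht => hβ t ((hmem t).2 ht)) (fun t ht => hβ' t (mt (hmem t).1 ht))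
  · rw [mem_last_iff_mem_range_first, List.mem_ofFn']
  · intro p t s hpts i hi
    obtain ⟨k, rfl, rfl, rfl⟩ := eq_take_of_ofFn_eq_append hpts
    rw [hw, ofFn_eq_take_append (fun i => X.first i :: ws i) k, List.flatten_append,
      List.flatten_cons, List.cons_append, List.append_assoc, List.cons_append] at h
    refine (h.source_pos hx hi).imp_right fun ⟨u, hu, hu'⟩ => ⟨u, ?_, hu'⟩
    obtain ⟨l, hl, hu⟩ := List.mem_flatten.1 hu
    obtain ⟨j, hj, rfl⟩ := mem_take_ofFn.1 hl
    obtain ⟨j', hj', rfl⟩ := hfirst j u hu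
    exact mem_take_ofFn.2 ⟨j', lt_of_le_of_lt hj' hj, rfl⟩
  · intro p t s hpts i hi
    obtain ⟨k, rfl, rfl, rfl⟩ := eq_take_of_ofFn_eq_append hpts
    rw [hw, ofFn_eq_take_append (fun i => X.last i :: vs i) k, List.flatten_append,
      List.flatten_cons, List.cons_append, ← List.append_assoc] at h
    refine (h.target_pos hx hi).imp_right fun ⟨u, hu, hu'⟩ => ⟨u, ?_, hu'⟩
    rcases List.mem_append.1 hu with hu | hu
    · obtain ⟨j, hj, rfl⟩ := hlast k u hu
      exact mem_drop_ofFn.2 ⟨j, hj, rfl⟩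
    · obtain ⟨l, hl, hu⟩ := List.mem_flatten.1 hu
      obtain ⟨j, hj, rfl⟩ := mem_drop_ofFn.1 hl
      rcases List.mem_cons.1 hu with rfl | hu
      · exact mem_drop_ofFn.2 ⟨j, hj, rfl⟩
      · obtain ⟨j', hj', rfl⟩ := hlast j u hu
        exact mem_drop_ofFn.2 ⟨j', hj.trans (le_of_lt hj'), rfl⟩

end Gathering

/-! ### Runs along path-schemes -/

section Schemes

open Filter

variable {α ι : Type*} {v : α → ι → ℚ}

theorem guarded_map_fst (P w : List α) : (guarded P w).map Prod.fst = w := by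
  induction w generalizing P with
  | nil => rfl
  | cons t w ih => simp [guarded, ih]

theorem unguarded_map_fst (w : List α) : (unguarded w).map Prod.fst = w := by
  simp [unguarded, Function.comp_def]

theorem unguarded_append (w w' : List α) : unguarded (w ++ w') = unguarded w ++ unguarded w' :=
  List.map_append

/-- Replacing the blocks of a run; the intermediate configurations are kept. -/
theorem GRun.eventually_flatten {κ : Type*} {f : Filter κ} {n : ℕ}
    {G : Fin n → List (α × List α × List α)} {G' : κ → Fin n → List (α × List α × List α)}
    (hG : ∀ i x y, (∀ j, 0 ≤ x j) → GRun v x (G i) y → ∀ᶠ N in f, GRun v x (G' N i) y)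
    {x y : ι → ℚ} (hx : ∀ j, 0 ≤ x j) (h : GRun v x (List.ofFn G).flatten y) :
    ∀ᶠ N in f, GRun v x (List.ofFn (G' N)).flatten y := by
  induction n generalizing x with
  | zero => simpa using Eventually.of_forall fun _ => h
  | succ n ih =>
    rw [List.ofFn_succ, List.flatten_cons, GRun.append_iff] at h
    obtain ⟨z, h0, h1⟩ := h
    have h2 := ih (G' := fun N i => G' N i.succ) (fun i => hG i.succ) (h0.nonneg hx) h1
    filter_upwards [hG 0 x z hx h0, h2] with N h3 h4
    rw [List.ofFn_succ, List.flatten_cons, GRun.append_iff]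
    exact ⟨z, h3, h4⟩

namespace PathScheme

/-- The items of the word `u₀ W₁ u₁ … Wₙ uₙ` where `Wᵢ` is the base word of the `i`-th gathering;
only the cuts within the words `Wᵢ` are guarded. -/
def items (ρ : PathScheme α) (X : Fin ρ.size → Gathering α) (N : ℕ) :
    List (α × List α × List α) :=
  unguarded (ρ.word 0) ++
    (List.ofFn fun i => guarded [] ((X i).baseWord N) ++ unguarded (ρ.word i.succ)).flatten

theorem items_map_fst (ρ : PathScheme α) (X : Fin ρ.size → Gathering α) (N : ℕ) :
    (ρ.items X N).map Prod.fst = ρ.assemble fun i => (X i).baseWord N := by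
  simp [items, assemble, unguarded_map_fst, guarded_map_fst, List.map_flatten, List.map_ofFn,
    Function.comp_def]

end PathScheme

end Schemes

namespace CVAS

open Filter

variable {d : ℕ} (T : CVAS d)

/-- The effects of the transitions, as rational vectors. -/
def effect (t : T) : Fin d → ℚ := fun i => t.1 i

/-- A configuration as a rational vector. -/
def toRat (x : Config d) : Fin d → ℚ := fun i => x i

variable {T}

theorem toRat_nonneg (x : Config d) (i : Fin d) : 0 ≤ toRat x i := (x i).2

theorem Run.gRun {x y : Config d} {w : List T} (h : T.Run x w y) :
    GRun T.effect (toRat x) (unguarded w) (toRat y) := by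
  induction h with
  | nil x => rfl
  | @cons x z y α t w hs _ ih =>
    have e : toRat x + α • T.effect t = toRat z := by
      funext i
      exact (hs.2.2 i).symm
    refine ⟨α, hs.1, hs.2.1, ?_⟩
    rw [e]
    exact ⟨toRat_nonneg z, by simp, ih⟩

theorem run_of_gRun {x y : Config d} {G : List (T × List T × List T)}
    (h : GRun T.effect (toRat x) G (toRat y)) : T.Run x (G.map Prod.fst) y := by
  induction G generalizing x with
  | nil =>
    have : x = y := by
      funext i
      exact NNRat.coe_injective (congrFun h i)
    exact this ▸ .nil x
  | cons g G ih =>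
    obtain ⟨t, P, Q⟩ := g
    obtain ⟨ε, h1, h2, h3, -, h5⟩ := h
    exact .cons (z := fun i => ⟨_, h3 i⟩) ⟨h1, h2, fun i => rfl⟩ (ih h5)

/-- A guarded run on the items of a path-scheme can be lifted to the whole upward closure. -/
theorem upClosure_le_of_gRun {x y : Config d} {ρ : PathScheme T} {X : Fin ρ.size → Gathering T}
    (hρ : ∀ i, ρ.bubble i = .gathering (X i)) {N : ℕ}
    (h : GRun T.effect (toRat x) (ρ.items X N) (toRat y)) :
    ρ.upClosure (fun i => (X i).baseWord N) ≤ ρ.language ⊓ T.language x y := by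
  rintro _ ⟨ws, hws, rfl⟩
  simp only [hρ, Bubble.upClosure] at hws
  refine ⟨⟨ws, fun i => ?_, rfl⟩, ?_⟩
  · rw [hρ]
    exact (hws i).1
  · change T.Run x (ρ.assemble ws) y
    rw [PathScheme.items, GRun.append_iff] at h
    obtain ⟨z, h0, h1⟩ := h
    have h2 := GRun.eventually_flatten (f := pure ())
      (G' := fun _ i => guarded [] (ws i) ++ unguarded (ρ.word i.succ)) (fun i x y hx h => by
        rw [GRun.append_iff] at h
        obtain ⟨z, h0, h1⟩ := h
        exact eventually_pure.2 (GRun.append_iff.2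
          ⟨z, Gathering.wRun_of_mem_upClosure hx h0 (hws i), h1⟩)) (h0.nonneg (toRat_nonneg x)) h1
    have h3 := run_of_gRun (GRun.append_iff.2 ⟨z, h0, eventually_pure.1 h2⟩)
    simpa [PathScheme.assemble, unguarded_map_fst, guarded_map_fst, List.map_flatten, List.map_ofFn,
      Function.comp_def] using h3

/-- A run on some word of a path-scheme yields guarded runs on its items. -/
theorem eventually_gRun {x y : Config d} {ρ : PathScheme T} {X : Fin ρ.size → Gathering T}
    (hρ : ∀ i, ρ.bubble i = .gathering (X i)) {w : List T}
    (hw : w ∈ ρ.language ⊓ T.language x y) :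
    ∀ᶠ N in atTop, GRun T.effect (toRat x) (ρ.items X N) (toRat y) := by
  obtain ⟨⟨ws, hws, rfl⟩, hrun⟩ := hw
  simp only [hρ, Bubble.language] at hws
  have h := Run.gRun hrun
  rw [PathScheme.assemble, unguarded_append, GRun.append_iff] at h
  obtain ⟨z, h0, h1⟩ := h
  have e : unguarded (List.ofFn fun i => ws i ++ ρ.word i.succ).flatten =
      (List.ofFn fun i => unguarded (ws i) ++ unguarded (ρ.word i.succ)).flatten := by
    simp [unguarded, List.map_flatten, List.map_ofFn, Function.comp_def]
  rw [e] at h1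
  have h2 := GRun.eventually_flatten (f := atTop)
    (G' := fun N i => guarded [] ((X i).baseWord N) ++ unguarded (ρ.word i.succ))
    (fun i x y hx h => by
      rw [GRun.append_iff] at h
      obtain ⟨z, h0, h1⟩ := h
      exact (Gathering.eventually_wRun hx (hws i) h0).mono fun N h =>
        GRun.append_iff.2 ⟨z, h, h1⟩) (h0.nonneg (toRat_nonneg x)) h1
  exact h2.mono fun N h => GRun.append_iff.2 ⟨z, h0, h⟩

end CVAS

/-! ### Numeric certificates of guarded runs -/

namespace Code

open Filter Nat

/-- Codes of the items of guarded runs. -/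
abbrev Item := Vec × Word × Word

/-- `D X`, `D Y` being the source and the target configuration with a common denominator `D`, the
item is fired with fraction `k / D`, and its guard holds for `Y`. A guard is checked in the form
`|u| ≤ D Y`, which is stronger than positivity, but equivalent to it for large `D`. -/
def StepOK (d D k : ℕ) (X Y : List ℕ) (g : Item) : Prop :=
  0 < k ∧ k ≤ D ∧
  (∀ j < d, Y.getD j 0 + k * (g.1.getD j (0, 0)).2 = X.getD j 0 + k * (g.1.getD j (0, 0)).1) ∧
  ∀ u ∈ g.2.1, ∀ u' ∈ g.2.2, u = u' →
    ∀ j < d, (u.getD j (0, 0)).1 + (u.getD j (0, 0)).2 ≤ Y.getD j 0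

/-- A certificate of a guarded run: a common denominator, the numerators of the firing fractions,
and the numerators of the visited configurations. -/
abbrev Cert := ℕ × List ℕ × List (List ℕ)

/-- The numerators `X` and the denominator `D` represent the configuration with code `x`. -/
def EndOK (D : ℕ) (X : List ℕ) (x : Conf) : Prop :=
  ∀ j < x.length, D * (x.getD j (0, 0)).1 = X.getD j 0 * (x.getD j (0, 0)).2

/-- `c` certifies a guarded run from `x` to `y` on the items `G`. -/
def CertOK (x y : Conf) (G : List Item) (c : Cert) : Prop :=
  0 < c.1 ∧ EndOK c.1 (c.2.2.getD 0 []) x ∧ EndOK c.1 (c.2.2.getD G.length []) y ∧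
  ∀ i < G.length, StepOK x.length c.1 (c.2.1.getD i 0) (c.2.2.getD i []) (c.2.2.getD (i + 1) [])
    (G.getD i ([], [], []))

variable {d : ℕ} {T : CVAS d}

/-- The code of an item. -/
def ofItem (g : T × List T × List T) : Item := (ofVec g.1.1, ofWord g.2.1, ofWord g.2.2)

theorem getD_ofFn {β : Type*} (f : Fin d → β) (b : β) (j : Fin d) :
    (List.ofFn f).getD j b = f j := by
  simp

theorem ofVec_getD (t : Fin d → ℤ) (j : Fin d) :
    (ofVec t).getD j (0, 0) = ((t j).toNat, (-t j).toNat) := getD_ofFn _ _ j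

theorem ofVec_injective : Function.Injective (ofVec (d := d)) := by
  intro t t' h
  funext j
  have := ofVec_getD t j
  rw [h, ofVec_getD, Prod.mk.injEq] at this
  omega

theorem length_ofConfig (x : Config d) : (ofConfig x).length = d := by simp [ofConfig]

/-- The configuration with numerators `X` and denominator `D`. -/
def ratOf (d D : ℕ) (X : List ℕ) : Fin d → ℚ := fun j => (X.getD j 0 : ℚ) / D

theorem gRun_of_stepOK {D : ℕ} (hD : 0 < D) (I : List (T × List T × List T)) (k : ℕ → ℕ)
    (m : ℕ → List ℕ)
    (h : ∀ i < I.length, StepOK d D (k i) (m i) (m (i + 1)) ((I.map ofItem).getD i ([], [], []))) :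
    GRun T.effect (ratOf d D (m 0)) I (ratOf d D (m I.length)) := by
  induction I generalizing k m with
  | nil => rfl
  | cons g I ih =>
    obtain ⟨t, P, Q⟩ := g
    obtain ⟨h1, h2, h3, h4⟩ := h 0 (by simp)
    simp only [List.map_cons, List.getD_cons_zero, ofItem, zero_add] at h1 h2 h3 h4
    have hD' : (0 : ℚ) < D := by exact_mod_cast hD
    have e : ratOf d D (m 0) + (k 0 / D : ℚ) • T.effect t = ratOf d D (m 1) := by
      funext j
      have h5 := h3 j j.2
      rw [ofVec_getD] at h5
      have h6 : ((m 1).getD j 0 : ℚ) + k 0 * ((-t.1 j).toNat : ℚ)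
          = (m 0).getD j 0 + k 0 * ((t.1 j).toNat : ℚ) := by exact_mod_cast h5
      have h7 : (t.1 j : ℚ) = (t.1 j).toNat - ((-t.1 j).toNat : ℚ) := by
        exact_mod_cast (Int.toNat_sub_toNat_neg (t.1 j)).symm
      simp only [Pi.add_apply, Pi.smul_apply, smul_eq_mul, ratOf, CVAS.effect, h7]
      field_simp
      linarith
    refine ⟨k 0 / D, div_pos (by exact_mod_cast h1) hD',
      (div_le_one hD').2 (by exact_mod_cast h2), ?_⟩
    rw [e]
    refine ⟨fun j => div_nonneg (Nat.cast_nonneg _) hD'.le, fun u hu hu' j hj => ?_, ?_⟩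
    · have h5 := h4 (ofVec u.1) (List.mem_map.2 ⟨u, hu, rfl⟩) _ (List.mem_map.2 ⟨u, hu', rfl⟩) rfl
        j j.2
      rw [ofVec_getD] at h5
      have h6 : u.1 j ≠ 0 := fun h => hj (by simp [CVAS.effect, h])
      refine div_pos ?_ hD'
      have : 0 < (m 1).getD j 0 := by dsimp only at h5; omega
      exact_mod_cast this
    · exact ih (fun i => k (i + 1)) (fun i => m (i + 1)) fun i hi => by
        simpa using h (i + 1) (by simpa using hi)

theorem toRat_eq_div (x : Config d) (j : Fin d) :
    CVAS.toRat x j = (x j).num / (x j).den := by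
  have h := Rat.num_div_den (x j : ℚ)
  rw [NNRat.num_coe, NNRat.den_coe, Int.cast_natCast] at h
  exact h.symm

theorem ratOf_eq_toRat {D : ℕ} (hD : 0 < D) {X : List ℕ} {x : Config d}
    (h : EndOK D X (ofConfig x)) : ratOf d D X = CVAS.toRat x := by
  funext j
  have h1 := h j (by simp [length_ofConfig])
  rw [ofConfig, getD_ofFn] at h1
  have hD' : (D : ℚ) ≠ 0 := by exact_mod_cast hD.ne'
  have hd : ((x j).den : ℚ) ≠ 0 := by exact_mod_cast (x j).den_ne_zero
  have h2 : (D : ℚ) * (x j).num = X.getD j 0 * (x j).den := by exact_mod_cast h1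
  rw [toRat_eq_div, ratOf]
  field_simp
  linarith

/-- Soundness of certificates. -/
theorem CertOK.gRun {x y : Config d} {I : List (T × List T × List T)} {c : Cert}
    (h : CertOK (ofConfig x) (ofConfig y) (I.map ofItem) c) :
    GRun T.effect (CVAS.toRat x) I (CVAS.toRat y) := by
  obtain ⟨h0, h1, h2, h3⟩ := h
  rw [← ratOf_eq_toRat h0 h1, ← ratOf_eq_toRat h0 h2, List.length_map]
  rw [List.length_map, length_ofConfig] at h3
  exact gRun_of_stepOK h0 I (fun i => c.2.1.getD i 0) (fun i => c.2.2.getD i []) h3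

/-- The numerators of a configuration with respect to the denominator `n!`. Rounding down makes no
difference for large `n`, see `eventually_scale`. -/
def scale (n : ℕ) (x : Fin d → ℚ) : List ℕ := List.ofFn fun j => ⌊(n ! : ℚ) * x j⌋₊

/-- The denominator of `q` divides `n!` for every large `n`. -/
theorem eventually_floor {q : ℚ} (hq : 0 ≤ q) :
    ∀ᶠ n in atTop, (⌊(n ! : ℚ) * q⌋₊ : ℚ) = n ! * q := by
  filter_upwards [eventually_ge_atTop q.den] with n hn
  obtain ⟨e, he⟩ := Nat.dvd_factorial q.den_pos hn
  obtain ⟨p, hp⟩ := Int.eq_ofNat_of_zero_le (Rat.num_nonneg.2 hq)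
  have h1 : (n ! : ℚ) * q = ((e * p : ℕ) : ℚ) := by
    have h3 : q * q.den = p := by
      rw [Rat.mul_den_eq_num, hp, Int.cast_natCast]
    rw [he]
    push_cast
    rw [← h3]
    ring
  rw [h1, Nat.floor_natCast]

theorem eventually_scale {x : Fin d → ℚ} (hx : ∀ j, 0 ≤ x j) :
    ∀ᶠ n in atTop, ∀ j : Fin d, ((scale n x).getD j 0 : ℚ) = n ! * x j := by
  refine eventually_all.2 fun j => ?_
  simp only [scale, getD_ofFn]
  exact eventually_floor (hx j)

theorem eventually_stepOK {t : T} {P Q : List T} {x : Fin d → ℚ} {ε : ℚ} (hx : ∀ j, 0 ≤ x j)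
    (h1 : 0 < ε) (h2 : ε ≤ 1) (h3 : ∀ i, 0 ≤ (x + ε • T.effect t) i)
    (h4 : ∀ u ∈ P, u ∈ Q → ∀ i, T.effect u i ≠ 0 → 0 < (x + ε • T.effect t) i) :
    ∀ᶠ n in atTop, StepOK d (n !) ⌊(n ! : ℚ) * ε⌋₊ (scale n x) (scale n (x + ε • T.effect t))
      (ofItem (t, P, Q)) := by
  have hg : ∀ᶠ n in atTop, ∀ u : T, ∀ j, u ∈ P → u ∈ Q → T.effect u j ≠ 0 →
      (((u.1 j).toNat + (-u.1 j).toNat : ℕ) : ℚ) ≤ n ! * (x + ε • T.effect t) j := by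
    refine eventually_all.2 fun u => eventually_all.2 fun j => ?_
    by_cases h : u ∈ P ∧ u ∈ Q ∧ T.effect u j ≠ 0
    · have hp := h4 u h.1 h.2.1 j h.2.2
      filter_upwards [tendsto_natCast_atTop_atTop.eventually_gt_atTop
        ((((u.1 j).toNat + (-u.1 j).toNat : ℕ) : ℚ) / (x + ε • T.effect t) j)] with n hn _ _ _
      rw [div_lt_iff₀ hp] at hn
      have : (n : ℚ) ≤ n ! := by exact_mod_cast Nat.self_le_factorial n
      exact hn.le.trans (mul_le_mul_of_nonneg_right this hp.le)
    · exact Eventually.of_forall fun n a b c => absurd ⟨a, b, c⟩ h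
  filter_upwards [hg, eventually_scale hx, eventually_scale h3, eventually_floor h1.le]
    with n hg hX hY hε
  have hn : (0 : ℚ) < n ! := by exact_mod_cast n.factorial_pos
  refine ⟨?_, ?_, fun j hj => ?_, ?_⟩
  · have : (0 : ℚ) < ⌊(n ! : ℚ) * ε⌋₊ := by rw [hε]; positivity
    exact_mod_cast this
  · have : (⌊(n ! : ℚ) * ε⌋₊ : ℚ) ≤ n ! := by rw [hε]; nlinarith
    exact_mod_cast this
  · have h5 := hX ⟨j, hj⟩
    have h6 := hY ⟨j, hj⟩
    have h7 := ofVec_getD t.1 ⟨j, hj⟩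
    dsimp only at h5 h6 h7
    dsimp only [ofItem]
    rw [h7]
    have h8 : T.effect t ⟨j, hj⟩ = (t.1 ⟨j, hj⟩).toNat - ((-t.1 ⟨j, hj⟩).toNat : ℚ) := by
      rw [CVAS.effect]
      exact_mod_cast (Int.toNat_sub_toNat_neg _).symm
    simp only [Pi.add_apply, Pi.smul_apply, smul_eq_mul, h8] at h6
    have : ((scale n (x + ε • T.effect t)).getD j 0 : ℚ)
        + ⌊(n ! : ℚ) * ε⌋₊ * ((-t.1 ⟨j, hj⟩).toNat : ℚ)
        = (scale n x).getD j 0 + ⌊(n ! : ℚ) * ε⌋₊ * ((t.1 ⟨j, hj⟩).toNat : ℚ) := by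
      rw [h5, h6, hε]; ring
    exact_mod_cast this
  · rintro _ hu _ hu' rfl j hj
    dsimp only [ofItem, ofWord] at hu hu'
    obtain ⟨u, hu₁, rfl⟩ := List.mem_map.1 hu
    obtain ⟨u', hu₂, he⟩ := List.mem_map.1 hu'
    obtain rfl : u' = u := Subtype.ext (ofVec_injective he)
    have h7 := ofVec_getD u'.1 ⟨j, hj⟩
    dsimp only at h7
    rw [h7]
    by_cases h0 : T.effect u' ⟨j, hj⟩ = 0
    · have : u'.1 ⟨j, hj⟩ = 0 := by simpa [CVAS.effect] using h0
      simp [this]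
    · have h8 := hg u' ⟨j, hj⟩ hu₁ hu₂ h0
      rw [← hY ⟨j, hj⟩] at h8
      exact_mod_cast h8

theorem eventually_exists_stepOK {I : List (T × List T × List T)} {x y : Fin d → ℚ}
    (hx : ∀ j, 0 ≤ x j) (h : GRun T.effect x I y) :
    ∀ᶠ n in atTop, ∃ (k : ℕ → ℕ) (m : ℕ → List ℕ), m 0 = scale n x ∧ m I.length = scale n y ∧
      ∀ i < I.length, StepOK d (n !) (k i) (m i) (m (i + 1))
        ((I.map ofItem).getD i ([], [], [])) := by
  induction I generalizing x with
  | nil =>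
    obtain rfl : x = y := h
    exact Eventually.of_forall fun n => ⟨fun _ => 0, fun _ => scale n x, rfl, rfl, by simp⟩
  | cons g I ih =>
    obtain ⟨t, P, Q⟩ := g
    obtain ⟨ε, h1, h2, h3, h4, h5⟩ := h
    filter_upwards [ih h3 h5, eventually_stepOK hx h1 h2 h3 h4] with n ⟨k, m, hm0, hm1, hm⟩ hs
    refine ⟨fun i => Nat.casesOn i ⌊(n ! : ℚ) * ε⌋₊ k, fun i => Nat.casesOn i (scale n x) m, rfl,
      hm1, fun i hi => ?_⟩
    cases i with
    | zero => simpa [hm0] using hs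
    | succ i => simpa using hm i (by simpa using hi)

theorem eventually_endOK (x : Config d) :
    ∀ᶠ n in atTop, EndOK (n !) (scale n (CVAS.toRat x)) (ofConfig x) := by
  filter_upwards [eventually_scale (CVAS.toRat_nonneg x)] with n hn j hj
  rw [length_ofConfig] at hj
  have h1 := hn ⟨j, hj⟩
  have h2 := getD_ofFn (fun i => ((x i).num, (x i).den)) (0, 0) ⟨j, hj⟩
  dsimp only at h1 h2
  rw [ofConfig, h2]
  have hd : ((x ⟨j, hj⟩).den : ℚ) ≠ 0 := by exact_mod_cast (x ⟨j, hj⟩).den_ne_zero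
  have : (n ! : ℚ) * (x ⟨j, hj⟩).num
      = (scale n (CVAS.toRat x)).getD j 0 * ((x ⟨j, hj⟩).den : ℚ) := by
    rw [h1, toRat_eq_div]
    field_simp
  exact_mod_cast this

theorem getD_map_range {β : Type*} (f : ℕ → β) (b : β) {i n : ℕ} (h : i < n) :
    ((List.range n).map f).getD i b = f i := by
  simp [h]

/-- Completeness of certificates. -/
theorem exists_certOK {x y : Config d} {I : List (T × List T × List T)}
    (h : GRun T.effect (CVAS.toRat x) I (CVAS.toRat y)) :
    ∃ c, CertOK (ofConfig x) (ofConfig y) (I.map ofItem) c := by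
  obtain ⟨n, ⟨k, m, hm0, hm1, hm⟩, hx, hy⟩ := ((eventually_exists_stepOK
    (CVAS.toRat_nonneg x) h).and ((eventually_endOK x).and (eventually_endOK y))).exists
  refine ⟨(n !, (List.range I.length).map k, (List.range (I.length + 1)).map m),
    n.factorial_pos, ?_, ?_, fun i hi => ?_⟩
  · rw [getD_map_range _ _ (Nat.succ_pos _), hm0]
    exact hx
  · rw [List.length_map, getD_map_range _ _ (Nat.lt_succ_self _), hm1]
    exact hy
  · rw [List.length_map] at hi
    rw [getD_map_range _ _ hi, getD_map_range _ _ (Nat.lt_succ_of_lt hi),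
      getD_map_range _ _ (Nat.succ_lt_succ hi), length_ofConfig]
    exact hm i hi

end Code

/-! ### The algorithm -/

namespace Code

/-- The pair of lists of letters of a gathering; a dummy for stars. -/
def toGath : Bub → Gath := Sum.elim (fun _ => ([], [])) id

/-- The code of the base word of a gathering. -/
def baseWord (g : Gath) (N : ℕ) : Word := g.1 ++ ((List.range N).flatMap (fun _ => g.1) ++ g.2)

/-- The codes of the items of a word with guards at all cuts. -/
def guardedItems (w : Word) : List Item :=
  (List.range w.length).map fun i => (w.getD i [], w.take (i + 1), w.drop (i + 1))

/-- The codes of the items of a word without guards. -/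
def unguardedItems (w : Word) : List Item := w.map fun t => (t, [], [])

/-- The codes of the items `PathScheme.items`. -/
def schemeItems (c : Scheme) (N : ℕ) : List Item :=
  unguardedItems (c.1.getD 0 []) ++ (List.range c.2.length).flatMap fun i =>
    guardedItems (baseWord (toGath (c.2.getD i (.inl []))) N) ++
      unguardedItems (c.1.getD (i + 1) [])

/-- The output for a path-scheme, if the base words are formed with the exponent `N`. -/
def output (c : Scheme) (N : ℕ) : Word × List Word :=
  ((schemeItems c N).map Prod.fst, c.2.map fun b => baseWord (toGath b) N)

/-- The search for an exponent together with a certificate. -/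
noncomputable def search (inp : Input Scheme) : Part (Word × List Word) := by
  classical
  exact Nat.rfindOpt fun n => (Encodable.decode (α := ℕ × Cert) n).bind fun c =>
    if CertOK inp.2.1 inp.2.2.1 (schemeItems inp.2.2.2 c.1) c.2 then some (output inp.2.2.2 c.1)
    else none

section Primrec

open Primrec

theorem primrec_toGath : Primrec toGath := by
  refine (Primrec.sumCasesOn (f := fun b : Bub => b) (g := fun _ _ => (([], []) : Gath))
    (h := fun _ g => g) Primrec.id (Primrec₂.const _) Primrec₂.right).of_eq fun b => ?_
  cases b <;> rfl

theorem primrec_baseWord : Primrec₂ baseWord :=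
  list_append.comp (Primrec.fst.comp Primrec.fst) (list_append.comp
    (list_flatMap (list_range.comp Primrec.snd)
      ((Primrec.fst.comp (Primrec.fst.comp Primrec.fst)).to₂)) (Primrec.snd.comp Primrec.fst))

theorem primrec_guardedItems : Primrec guardedItems :=
  list_map (list_range.comp list_length) (Primrec.pair
    ((list_getD []).comp Primrec.fst Primrec.snd) (Primrec.pair
      (list_take.comp (Primrec.succ.comp Primrec.snd) Primrec.fst)
      (list_drop.comp (Primrec.succ.comp Primrec.snd) Primrec.fst))).to₂

theorem primrec_unguardedItems : Primrec unguardedItems :=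
  list_map Primrec.id (Primrec.pair Primrec.snd (Primrec.const ([], []))).to₂

theorem primrec_schemeItems : Primrec₂ schemeItems :=
  list_append.comp
    (primrec_unguardedItems.comp ((list_getD []).comp (Primrec.fst.comp Primrec.fst)
      (Primrec.const 0)))
    (list_flatMap (list_range.comp (list_length.comp (Primrec.snd.comp Primrec.fst)))
      (list_append.comp
        (primrec_guardedItems.comp (primrec_baseWord.comp
          (primrec_toGath.comp ((list_getD _).comp
            (Primrec.snd.comp (Primrec.fst.comp Primrec.fst)) Primrec.snd))
          (Primrec.snd.comp Primrec.fst)))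
        (primrec_unguardedItems.comp ((list_getD []).comp
          (Primrec.fst.comp (Primrec.fst.comp Primrec.fst))
          (Primrec.succ.comp Primrec.snd)))).to₂)

theorem primrec_output : Primrec₂ output :=
  Primrec.pair (list_map primrec_schemeItems (Primrec.fst.comp Primrec.snd).to₂)
    (list_map (Primrec.snd.comp Primrec.fst) (primrec_baseWord.comp
      (primrec_toGath.comp Primrec.snd) (Primrec.snd.comp Primrec.fst)).to₂)

variable {α : Type} [Primcodable α]

theorem primrecPred_forall_mem {β : Type} [Primcodable β] {p : β → α → Prop} (hp : PrimrecRel p)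
    {f : α → List β} (hf : Primrec f) : PrimrecPred fun a => ∀ b ∈ f a, p b a :=
  PrimrecRel.comp (R := fun (l : List β) a => ∀ b ∈ l, p b a) hp.forall_mem_list hf Primrec.id

theorem primrecPred_forall_lt {p : ℕ → α → Prop} (hp : PrimrecRel p) {f : α → ℕ}
    (hf : Primrec f) : PrimrecPred fun a => ∀ i < f a, p i a :=
  (primrecPred_forall_mem hp (list_range.comp hf)).of_eq fun a => by simp

theorem primrecPred_imp {p q : α → Prop} (hp : PrimrecPred p) (hq : PrimrecPred q) :
    PrimrecPred fun a => p a → q a :=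
  (hp.not.or hq).of_eq fun _ => imp_iff_not_or.symm

theorem primrecPred_endOK {D : α → ℕ} {X : α → List ℕ} {x : α → Conf} (hD : Primrec D)
    (hX : Primrec X) (hx : Primrec x) : PrimrecPred fun a => EndOK (D a) (X a) (x a) := by
  refine primrecPred_forall_lt (p := fun j a => D a * ((x a).getD j (0, 0)).1
    = (X a).getD j 0 * ((x a).getD j (0, 0)).2) ?_ (list_length.comp hx)
  have hxj := (list_getD ((0, 0) : ℕ × ℕ)).comp (hx.comp Primrec.snd) (Primrec.fst (α := ℕ))
  exact Primrec.eq.comp (nat_mul.comp (hD.comp Primrec.snd) (Primrec.fst.comp hxj))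
    (nat_mul.comp ((list_getD 0).comp (hX.comp Primrec.snd) Primrec.fst) (Primrec.snd.comp hxj))

theorem primrecPred_stepOK {d D k : α → ℕ} {X Y : α → List ℕ} {g : α → Item} (hd : Primrec d)
    (hD : Primrec D) (hk : Primrec k) (hX : Primrec X) (hY : Primrec Y) (hg : Primrec g) :
    PrimrecPred fun a => StepOK (d a) (D a) (k a) (X a) (Y a) (g a) := by
  refine (nat_lt.comp (Primrec.const 0) hk).and ((nat_le.comp hk hD).and (.and ?_ ?_))
  · refine primrecPred_forall_lt (p := fun j a =>
      (Y a).getD j 0 + k a * ((g a).1.getD j (0, 0)).2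
        = (X a).getD j 0 + k a * ((g a).1.getD j (0, 0)).1) ?_ hd
    have ht := (list_getD ((0, 0) : ℕ × ℕ)).comp
      (Primrec.fst.comp (hg.comp Primrec.snd)) (Primrec.fst (α := ℕ))
    exact Primrec.eq.comp
      (nat_add.comp ((list_getD 0).comp (hY.comp Primrec.snd) Primrec.fst)
        (nat_mul.comp (hk.comp Primrec.snd) (Primrec.snd.comp ht)))
      (nat_add.comp ((list_getD 0).comp (hX.comp Primrec.snd) Primrec.fst)
        (nat_mul.comp (hk.comp Primrec.snd) (Primrec.fst.comp ht)))
  · refine primrecPred_forall_mem (p := fun u a => ∀ u' ∈ (g a).2.2, u = u' →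
      ∀ j < d a, (u.getD j (0, 0)).1 + (u.getD j (0, 0)).2 ≤ (Y a).getD j 0) ?_
      (Primrec.fst.comp (Primrec.snd.comp hg))
    refine primrecPred_forall_mem (p := fun (u' : Vec) (b : Vec × α) => b.1 = u' →
      ∀ j < d b.2, (b.1.getD j (0, 0)).1 + (b.1.getD j (0, 0)).2 ≤ (Y b.2).getD j 0) ?_
      (Primrec.snd.comp (Primrec.snd.comp (hg.comp Primrec.snd)))
    refine primrecPred_imp (Primrec.eq.comp (Primrec.fst.comp Primrec.snd) Primrec.fst) ?_
    refine primrecPred_forall_lt (p := fun j (b : Vec × Vec × α) =>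
      (b.2.1.getD j (0, 0)).1 + (b.2.1.getD j (0, 0)).2 ≤ (Y b.2.2).getD j 0) ?_
      (hd.comp (Primrec.snd.comp Primrec.snd))
    have hu := (list_getD ((0, 0) : ℕ × ℕ)).comp
      (Primrec.fst.comp (Primrec.snd.comp (Primrec.snd (α := ℕ) (β := Vec × Vec × α))))
      Primrec.fst
    exact nat_le.comp (nat_add.comp (Primrec.fst.comp hu) (Primrec.snd.comp hu))
      ((list_getD 0).comp (hY.comp (Primrec.snd.comp (Primrec.snd.comp Primrec.snd))) Primrec.fst)

theorem primrecPred_certOK {x y : α → Conf} {G : α → List Item} {c : α → Cert} (hx : Primrec x)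
    (hy : Primrec y) (hG : Primrec G) (hc : Primrec c) :
    PrimrecPred fun a => CertOK (x a) (y a) (G a) (c a) := by
  have hD := Primrec.fst.comp hc
  have hk := Primrec.fst.comp (Primrec.snd.comp hc)
  have hM := Primrec.snd.comp (Primrec.snd.comp hc)
  refine (nat_lt.comp (Primrec.const 0) hD).and (.and ?_ (.and ?_ ?_))
  · exact primrecPred_endOK hD ((list_getD []).comp hM (Primrec.const 0)) hx
  · exact primrecPred_endOK hD ((list_getD []).comp hM (list_length.comp hG)) hy
  · refine primrecPred_forall_lt (p := fun i a => StepOK (x a).length (c a).1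
      ((c a).2.1.getD i 0) ((c a).2.2.getD i []) ((c a).2.2.getD (i + 1) [])
      ((G a).getD i ([], [], []))) ?_ (list_length.comp hG)
    exact primrecPred_stepOK (list_length.comp (hx.comp Primrec.snd)) (hD.comp Primrec.snd)
      ((list_getD 0).comp (hk.comp Primrec.snd) Primrec.fst)
      ((list_getD []).comp (hM.comp Primrec.snd) Primrec.fst)
      ((list_getD []).comp (hM.comp Primrec.snd) (Primrec.succ.comp Primrec.fst))
      ((list_getD ([], [], [])).comp (hG.comp Primrec.snd) Primrec.fst)

theorem partrec_search : Partrec search := by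
  classical
  refine Partrec.rfindOpt (Primrec.to_comp ?_)
  refine Primrec.option_bind (Primrec.decode.comp Primrec.snd) ?_
  have hc := Primrec.snd (α := Input Scheme × ℕ) (β := ℕ × Cert)
  have hi := (Primrec.fst (α := Input Scheme) (β := ℕ)).comp
    (Primrec.fst (β := ℕ × Cert))
  have hs := Primrec.snd.comp (Primrec.snd.comp (Primrec.snd.comp hi))
  refine Primrec.ite (primrecPred_certOK (Primrec.fst.comp (Primrec.snd.comp hi))
    (Primrec.fst.comp (Primrec.snd.comp (Primrec.snd.comp hi)))
    (primrec_schemeItems.comp hs (Primrec.fst.comp hc)) (Primrec.snd.comp hc))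
    (Primrec.option_some.comp (primrec_output.comp hs (Primrec.fst.comp hc))) (Primrec.const none)

end Primrec

end Code

/-! ### Correctness of the algorithm -/

namespace Code

variable {d : ℕ} {T : CVAS d}

theorem ofWord_append (w w' : List T) : ofWord (w ++ w') = ofWord w ++ ofWord w' :=
  List.map_append

theorem map_guarded (P w : List T) :
    (guarded P w).map ofItem = (List.range (ofWord w).length).map fun i =>
      ((ofWord w).getD i [], ofWord P ++ (ofWord w).take (i + 1), (ofWord w).drop (i + 1)) := by
  induction w generalizing P with
  | nil => rfl
  | cons t w ih =>
    have e : ofWord (t :: w) = ofVec t.1 :: ofWord w := rfl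
    rw [guarded, List.map_cons, ih, e, List.length_cons, List.range_succ_eq_map, List.map_cons,
      List.map_map]
    congr 1
    · simp [ofItem, ofWord]
    · refine List.map_congr_left fun i _ => ?_
      simp [ofWord]

theorem map_guarded_nil (w : List T) : (guarded [] w).map ofItem = guardedItems (ofWord w) := by
  simp [map_guarded, guardedItems, ofWord]

theorem map_unguarded (w : List T) :
    (unguarded w).map ofItem = unguardedItems (ofWord w) := by
  simp [unguarded, unguardedItems, ofWord, ofItem, Function.comp_def]

theorem baseWord_ofGathering (X : Gathering T) (N : ℕ) :
    baseWord (ofGathering X) N = ofWord (X.baseWord N) := by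
  have : (List.range N).flatMap (fun _ => ofWord (List.ofFn X.first)) =
      ofWord (List.replicate N (List.ofFn X.first)).flatten := by
    simp only [ofWord, List.flatMap_def, List.map_const', List.length_range, List.map_flatten,
      List.map_replicate]
  simp [baseWord, Gathering.baseWord, ofGathering, ofWord_append, this]

theorem flatten_ofFn_eq_flatMap {β : Type*} {n : ℕ} (f : Fin n → List β) (F : ℕ → List β)
    (h : ∀ i, f i = F i) : (List.ofFn f).flatten = (List.range n).flatMap F := by
  rw [List.flatMap_def]
  congr 1
  refine List.ext_getElem (by simp) fun i h1 h2 => ?_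
  simp [h]

theorem ofWord_map_fst (I : List (T × List T × List T)) :
    (I.map ofItem).map Prod.fst = ofWord (I.map Prod.fst) := by
  simp [ofWord, ofItem, Function.comp_def]

variable {ρ : PathScheme T} {X : Fin ρ.size → Gathering T}

theorem IsScheme.eq_ofFn {c : Scheme} (hc : IsScheme ρ c)
    (hX : ∀ i, ρ.bubble i = .gathering (X i)) :
    c.2 = List.ofFn fun i => .inr (ofGathering (X i)) := by
  obtain ⟨-, β, hβ, h⟩ := hc
  rw [h]
  congr 1
  funext i
  have := hβ i
  rw [hX] at this
  generalize β i = b at this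
  cases this
  rfl

theorem schemeItems_eq {c : Scheme} (hc : IsScheme ρ c)
    (hX : ∀ i, ρ.bubble i = .gathering (X i)) (N : ℕ) :
    schemeItems c N = (ρ.items X N).map ofItem := by
  rw [schemeItems, hc.eq_ofFn hX, hc.1, PathScheme.items, List.map_append, map_unguarded,
    List.map_flatten, List.map_ofFn, List.length_ofFn]
  congr 1
  · rw [← getD_ofFn (fun i => ofWord (ρ.word i)) [] 0]
    rfl
  · symm
    refine flatten_ofFn_eq_flatMap _ _ fun i => ?_
    rw [Function.comp_apply, List.map_append, map_guarded_nil, map_unguarded, getD_ofFn]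
    have := getD_ofFn (fun i => ofWord (ρ.word i)) [] i.succ
    rw [Fin.val_succ] at this
    rw [this, ← baseWord_ofGathering]
    rfl

theorem output_eq {c : Scheme} (hc : IsScheme ρ c)
    (hX : ∀ i, ρ.bubble i = .gathering (X i)) (N : ℕ) :
    output c N = (ofWord (ρ.assemble fun i => (X i).baseWord N),
      List.ofFn fun i => ofWord ((X i).baseWord N)) := by
  rw [output, schemeItems_eq hc hX, ofWord_map_fst, PathScheme.items_map_fst, hc.eq_ofFn hX,
    List.map_ofFn]
  simp [Function.comp_def, toGath, baseWord_ofGathering]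

/-- The search succeeds, and all its results can be lifted. -/
theorem search_spec {x y : Config d} {cT : List Vec} {c : Scheme} (hc : IsScheme ρ c)
    (hX : ∀ i, ρ.bubble i = .gathering (X i)) (h : ∃ w, w ∈ ρ.language ⊓ T.language x y) :
    ∃ N, (ofWord (ρ.assemble fun i => (X i).baseWord N),
        List.ofFn fun i => ofWord ((X i).baseWord N)) ∈
          search (cT, ofConfig x, ofConfig y, c) ∧
      ρ.upClosure (fun i => (X i).baseWord N) ≤ ρ.language ⊓ T.language x y := by
  classical
  have hdom : (search (cT, ofConfig x, ofConfig y, c)).Dom := by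
    obtain ⟨w, hw⟩ := h
    obtain ⟨N, hN⟩ := (CVAS.eventually_gRun hX hw).exists
    obtain ⟨k, hk⟩ := exists_certOK hN
    rw [← schemeItems_eq hc hX] at hk
    refine Nat.rfindOpt_dom.2 ⟨Encodable.encode (N, k), output c N, ?_⟩
    rw [Encodable.encodek]
    simp [hk]
  obtain ⟨n, hn⟩ := Nat.rfindOpt_spec (Part.get_mem hdom)
  obtain ⟨⟨N, k⟩, -, hk⟩ := Option.bind_eq_some_iff.1 hn
  dsimp only at hk
  split_ifs at hk with hok
  rw [schemeItems_eq hc hX] at hok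
  refine ⟨N, ?_, CVAS.upClosure_le_of_gRun hX hok.gRun⟩
  rw [← output_eq hc hX, Option.some.inj hk]
  exact Part.get_mem hdom

theorem self_mem_upClosure (hX : ∀ i, ρ.bubble i = .gathering (X i)) (N : ℕ) :
    ρ.assemble (fun i => (X i).baseWord N) ∈ ρ.upClosure fun i => (X i).baseWord N := by
  refine ⟨_, fun i => ?_, rfl⟩
  rw [hX]
  exact ⟨⟨_, Gathering.hasCenter_baseWord N⟩, List.Sublist.refl _⟩

/-- A gathering as a path-scheme with a single bubble. -/
def single (X : Gathering T) : PathScheme T := ⟨1, fun _ => [], fun _ => .gathering X⟩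

theorem isScheme_single (X : Gathering T) :
    IsScheme (single X) ([[], []], [.inr (ofGathering X)]) :=
  ⟨rfl, fun _ => .inr (ofGathering X), fun _ => .gathering X, rfl⟩

theorem assemble_single (X : Gathering T) (ws : Fin (single X).size → List T) :
    (single X).assemble ws = ws (0 : Fin 1) := by
  simp only [PathScheme.assemble, single, List.ofFn_succ, List.ofFn_zero]
  simp

theorem language_single (X : Gathering T) : (single X).language = X.language := by
  ext w
  constructor
  · rintro ⟨ws, hws, rfl⟩
    rw [assemble_single]
    exact hws (0 : Fin 1)
  · exact fun hw => ⟨fun _ => w, fun _ => hw, (assemble_single X fun _ => w).symm⟩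

theorem upClosure_le_single (X : Gathering T) (w : List T) :
    X.upClosure w ≤ (single X).upClosure fun _ => w :=
  fun w' hw' => ⟨fun _ => w', fun _ => hw', (assemble_single X fun _ => w').symm⟩

end Code

theorem mainTheorem5 :
    -- gatherings
    (∃ F : Code.Input Code.Gath →. Code.Word, Partrec F ∧
      ∀ (d : ℕ) (T : CVAS d) (x y : Config d) (X : Gathering T) (cT : List Code.Vec),
        Code.IsCVAS T cT →
        (∃ w, w ∈ X.language ⊓ T.language x y) →
        ∃ w : List T,
          Code.ofWord w ∈ F (cT, Code.ofConfig x, Code.ofConfig y, Code.ofGathering X) ∧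
          w ∈ X.language ⊓ T.language x y ∧
          X.upClosure w ≤ X.language ⊓ T.language x y) ∧
    -- path-schemes
    (∃ F : Code.Input Code.Scheme →. Code.Word × List Code.Word, Partrec F ∧
      ∀ (d : ℕ) (T : CVAS d) (x y : Config d) (ρ : PathScheme T) (cT : List Code.Vec)
        (cρ : Code.Scheme), Code.IsCVAS T cT → Code.IsScheme ρ cρ →
        ρ.IsPerfect x y →
        ∃ (w : List T) (ws : Fin ρ.size → List T),
          (Code.ofWord w, List.ofFn fun i => Code.ofWord (ws i)) ∈
            F (cT, Code.ofConfig x, Code.ofConfig y, cρ) ∧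
          w ∈ ρ.language ⊓ T.language x y ∧
          ρ.IsFactor w ws ∧
          ρ.upClosure ws ≤ ρ.language ⊓ T.language x y) := by
  constructor
  · refine ⟨fun inp => (Code.search (inp.1, inp.2.1, inp.2.2.1,
      [[], []], [.inr inp.2.2.2])).map Prod.fst, ?_, ?_⟩
    · have hs : Primrec fun g : Code.Gath => [(Sum.inr g : Code.Bub)] :=
        Primrec.list_cons.comp (Primrec.sumInr.comp Primrec.id) (Primrec.const [])
      have h : Primrec fun inp : Code.Input Code.Gath => ((inp.1, inp.2.1, inp.2.2.1,
          [[], []], [.inr inp.2.2.2]) : Code.Input Code.Scheme) :=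
        Primrec.pair Primrec.fst (Primrec.pair (Primrec.fst.comp Primrec.snd)
          (Primrec.pair (Primrec.fst.comp (Primrec.snd.comp Primrec.snd))
            (Primrec.pair (Primrec.const [[], []])
              (hs.comp (Primrec.snd.comp (Primrec.snd.comp Primrec.snd))))))
      exact (Code.partrec_search.comp h.to_comp).map (Computable.fst.comp Computable.snd).to₂
    · intro d T x y X cT _ hw
      rw [← Code.language_single] at hw ⊢
      have hX : ∀ i, (Code.single X).bubble i = .gathering X := fun _ => rfl
      obtain ⟨N, hN, hup⟩ := Code.search_spec (X := fun _ => X) (cT := cT)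
        (Code.isScheme_single X) hX hw
      have hmem := hup (Code.self_mem_upClosure hX N)
      rw [Code.assemble_single] at hN hmem
      exact ⟨_, (Part.mem_map_iff _).2 ⟨_, hN, rfl⟩, hmem,
        (Code.upClosure_le_single X _).trans hup⟩
  · refine ⟨Code.search, Code.partrec_search, ?_⟩
    rintro d T x y ρ cT c _ hc ⟨hρ, hw⟩
    choose X hX using hρ
    obtain ⟨N, hN, hup⟩ := Code.search_spec (cT := cT) hc hX hw
    have hself := Code.self_mem_upClosure hX N
    refine ⟨_, _, hN, hup hself, ⟨fun i => ?_, rfl⟩, hup⟩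
    rw [hX]
    exact ⟨_, Gathering.hasCenter_baseWord N⟩
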